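/- Let $k$ be an algebraically closed field of characteristic zero, $G$ a finite group and $n\ge 1$. By a $G$-variety over $k$ we mean a reduced separated scheme of finite type over $k$ with a $G$-action over $k$ that permutes its irreducible components transitively (so several components are allowed); the action is called generically free if some point of $X(k)$ has trivial stabilizer (equivalently, the points with trivial stabilizer are dense). Let $\mathbb Z[\mathrm{Bir}_{G,n-1}]$ be the free abelian group on $G$-equivariant birational equivalence classes of $(n-1)$-dimensional $G$-varieties over $k$ with generically free action. Let $X,Y$ be smooth projective $G$-varieties of dimension $n$ over $k$ with generically free $G$-action and let $\phi\colon X\dashrightarrow Y$ be a $G$-equivariant birational map over $k$. The exceptional locus of $\phi$ is the complement in $X$ of the largest open subset on which $\phi$ is an isomorphism onto an open subset of $Y$. Let $\mathrm{Ex}_G(\phi)$ be the (finite) set of $G$-orbits of irreducible components of dimension $n-1$ of the exceptional locus of $\phi$. The union of the members of such an orbit, with its reduced structure, is a $G$-variety of dimension $n-1$; we say that its generic stabilizer is trivial if the $G$-action on it is generically free, and then write $[E\circlearrowleft G]$ for its class in $\mathbb Z[\mathrm{Bir}_{G,n-1}]$. Put $$C_G(\phi):=\sum_{\substack{E\in\mathrm{Ex}_G(\phi^{-1})\\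 \mathrm{gen.\,stab}(E)=\{1\}}}[E\circlearrowleft G]\;-\sum_{\substack{D\in\mathrm{Ex}_G(\phi)\\ \mathrm{gen.\,stab}(D)=\{1\}}}[D\circlearrowleft G]\;\in\;\mathbb Z[\mathrm{Bir}_{G,n-1}].$$ Theorem. For all smooth projective $G$-varieties $X,Y,Z$ of dimension $n$ over $k$ with generically free $G$-action and all $G$-equivariant birational maps $X\stackrel{\phi}{\dashrightarrow}Y\stackrel{\psi}{\dashrightarrow}Z$ over $k$, $$C_G(\psi\circ\phi)=C_G(\phi)+C_G(\psi).$$ -/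

import Mathlib

open CategoryTheory AlgebraicGeometry TopologicalSpace

universe u v

noncomputable section

namespace EquivBir

/-! ### Varieties with an action of a finite group -/

/-- A `d`-dimensional `G`-variety over `k` with generically free `G`-action: a reduced separated
scheme of finite type over `k` with a `G`-action over `k` which permutes its irreducible components
transitively and for which some closed point has trivial stabilizer.
(The base field will be algebraically closed, so that closed points are the same as `k`-points. The
locus with trivial stabilizer is open and `G`-stable, so by transitivity it is dense as soon as it
is nonempty.) -/
structure GVariety (k : Type u) [Field k] (G : Type v) [Group G] (d : ℕ) where
  /-- the underlying scheme -/
  carrier : Scheme.{u}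
  /-- the structure morphism -/
  str : carrier ⟶ Spec (.of k)
  /-- the action -/
  act : G → (carrier ⟶ carrier)
  act_one : act 1 = 𝟙 carrier
  act_mul : ∀ g h, act (g * h) = act h ≫ act g
  act_str : ∀ g, act g ≫ str = str
  isReduced : IsReduced carrier
  isSeparated : IsSeparated str
  locallyOfFiniteType : LocallyOfFiniteType str
  quasiCompact : QuasiCompact str
  dim_eq : topologicalKrullDim carrier = d
  transitive : ∀ C ∈ irreducibleComponents carrier, ∀ C' ∈ irreducibleComponents carrier,
    ∃ g, (act g) '' C = C'
  genericallyFree : ∃ x : carrier, IsClosed {x} ∧ ∀ g ≠ 1, (act g) x ≠ x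

attribute [local instance] MvPolynomial.gradedAlgebra

/-- The structure morphism of projective `N`-space over `k`. -/
def projectiveSpaceStr (k : Type u) [Field k] (N : ℕ) :
    Proj (MvPolynomial.homogeneousSubmodule (Fin (N + 1)) k) ⟶ Spec (.of k) :=
  Proj.toSpecZero _ ≫ Spec.map (CommRingCat.ofHom
    (algebraMap k (MvPolynomial.homogeneousSubmodule (Fin (N + 1)) k 0)))

namespace GVariety

variable {k : Type u} [Field k] {G : Type v} [Group G] {d : ℕ}

/-- The automorphism by which `g` acts. -/
@[simps] def actIso (V : GVariety k G d) (g : G) : V.carrier ≅ V.carrier where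
  hom := V.act g
  inv := V.act g⁻¹
  hom_inv_id := by rw [← V.act_mul, inv_mul_cancel, V.act_one]
  inv_hom_id := by rw [← V.act_mul, mul_inv_cancel, V.act_one]

/-- The underlying variety is smooth over `k` and a closed subscheme of some projective space. -/
structure IsSmoothProjective (V : GVariety k G d) : Prop where
  smooth : Smooth V.str
  projective : ∃ (N : ℕ)
    (i : V.carrier ⟶ Proj (MvPolynomial.homogeneousSubmodule (Fin (N + 1)) k)),
    IsClosedImmersion i ∧ i ≫ projectiveSpaceStr k N = V.str

/-! ### Equivariant birational maps -/

/-- A birational map, represented by an isomorphism `φ` between dense open subschemes, is a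
`G`-equivariant birational map over `k` if `φ` commutes with the structure morphisms and if, for
all `g`, the rational maps `φ ∘ g` and `g ∘ φ` agree. -/
structure IsEquivariantBirational {V W : GVariety k G d}
    (φ : V.carrier.PartialIso W.carrier) : Prop where
  isOver : φ.IsOver V.str W.str
  equivariant : ∀ g : G,
    ((Scheme.PartialIso.ofIso (V.actIso g)).trans φ).toRationalMap =
      (φ.trans (Scheme.PartialIso.ofIso (W.actIso g))).toRationalMap

/-- `V` and `W` are `G`-equivariantly birational. -/
def Birational (V W : GVariety k G d) : Prop :=
  ∃ φ : V.carrier.PartialIso W.carrier, IsEquivariantBirational φ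

end GVariety

/-- The set of `G`-equivariant birational equivalence classes of `d`-dimensional varieties with
generically free `G`-action. (`Birational` is an equivalence relation, since equivariant birational
maps can be composed and inverted.) -/
def BirClass (k : Type u) [Field k] (G : Type v) [Group G] (d : ℕ) :=
  Quot (GVariety.Birational (k := k) (G := G) (d := d))

/-- The free abelian group on `BirClass k G d`. -/
abbrev ZBir (k : Type u) [Field k] (G : Type v) [Group G] (d : ℕ) :=
  FreeAbelianGroup (BirClass k G d)

/-! ### Exceptional loci -/

/-- The exceptional locus of a birational map: the complement of the largest open set on which the
map is (defined and) an isomorphism onto an open subset of the target. It depends only on the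
rational map given by `φ`. -/
def exceptionalLocus {X Y : Scheme.{u}} (φ : X.PartialIso Y) : Set X :=
  {x | ∀ φ' : X.PartialIso Y, φ'.toRationalMap = φ.toRationalMap → x ∉ φ'.source}

lemma isClosed_exceptionalLocus {X Y : Scheme.{u}} (φ : X.PartialIso Y) :
    IsClosed (exceptionalLocus φ) := by
  have : exceptionalLocus φ = ⋂ (φ' : X.PartialIso Y)
      (_ : φ'.toRationalMap = φ.toRationalMap), ((φ'.source : Set X))ᶜ := by
    ext x; simp [exceptionalLocus]
  rw [this]
  exact isClosed_iInter fun φ' => isClosed_iInter fun _ => φ'.source.isOpen.isClosed_compl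

/-- The irreducible components of dimension `m` of a subset `S` of a topological space. -/
def componentsOfDim {X : Type*} [TopologicalSpace X] (S : Set X) (m : ℕ) : Set (Set X) :=
  {D | Maximal (fun T => IsIrreducible T ∧ T ⊆ S) D ∧ topologicalKrullDim D = m}

section Topology

variable {X : Type*} [TopologicalSpace X]

lemma isClosed_of_mem_componentsOfDim {S : Set X} (hS : IsClosed S) {m : ℕ} {D : Set X}
    (hD : D ∈ componentsOfDim S m) : IsClosed D := by
  refine isClosed_of_closure_subset ?_
  exact hD.1.2 ⟨hD.1.1.1.closure, closure_minimal hD.1.1.2 hS⟩ subset_closure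

lemma finite_componentsOfDim [NoetherianSpace X] {S : Set X} (hS : IsClosed S) (m : ℕ) :
    (componentsOfDim S m).Finite := by
  obtain ⟨F, hF, hFc, hFi, rfl⟩ := NoetherianSpace.exists_finite_set_isClosed_irreducible hS
  refine hF.subset fun D hD => ?_
  obtain ⟨T, hT, hDT⟩ := (isIrreducible_iff_sUnion_isClosed.mp hD.1.1.1) hF.toFinset
    (fun T hT => hFc T (by simpa using hT)) (by simpa using hD.1.1.2)
  have hT' : T ∈ F := by simpa using hT
  have : D = T := hDT.antisymm (hD.1.2 ⟨hFi T hT', Set.subset_sUnion_of_mem hT'⟩ hDT)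
  exact this ▸ hT'

lemma exists_subset_of_isIrreducible {ι : Type*} [Finite ι] {D : ι → Set X}
    (hD : ∀ i, IsClosed (D i)) {T : Set X} (hT : IsIrreducible T) (h : T ⊆ ⋃ i, D i) :
    ∃ i, T ⊆ D i := by
  obtain ⟨S, hS, hTS⟩ := (isIrreducible_iff_sUnion_isClosed.mp hT)
    (Set.finite_range D).toFinset (by simpa using hD) (by simpa using h)
  obtain ⟨i, rfl⟩ : ∃ i, D i = S := by simpa using hS
  exact ⟨i, hTS⟩

lemma isIrreducible_preimage {Y : Type*} [TopologicalSpace Y] {f : Y → X}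
    (hf : Topology.IsEmbedding f) {T : Set X} (hT : IsIrreducible T) (h : T ⊆ Set.range f) :
    IsIrreducible (f ⁻¹' T) := by
  refine ⟨?_, ?_⟩
  · obtain ⟨x, hx⟩ := hT.1
    obtain ⟨y, rfl⟩ := h hx
    exact ⟨y, hx⟩
  · intro u v hu hv ⟨x, hx, hxu⟩ ⟨y, hy, hyv⟩
    obtain ⟨U, hU, rfl⟩ := hf.isInducing.isOpen_iff.mp hu
    obtain ⟨V, hV, rfl⟩ := hf.isInducing.isOpen_iff.mp hv
    obtain ⟨z, hz, hzU, hzV⟩ := hT.2 U V hU hV ⟨f x, hx, hxu⟩ ⟨f y, hy, hyv⟩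
    obtain ⟨w, rfl⟩ := h hz
    exact ⟨w, hz, hzU, hzV⟩

lemma topologicalKrullDim_iUnion_le {ι : Type*} [Finite ι] {D : ι → Set X}
    (hD : ∀ i, IsClosed (D i)) {m : ℕ} (hm : ∀ i, topologicalKrullDim (D i) ≤ m) :
    topologicalKrullDim (⋃ i, D i : Set X) ≤ m := by
  refine iSup_le fun p => ?_
  have hp : IsIrreducible ((↑) '' (p.last : Set (⋃ i, D i : Set X)) : Set X) :=
    p.last.isIrreducible.image _ continuous_subtype_val.continuousOn
  obtain ⟨i, hi⟩ := exists_subset_of_isIrreducible hD hp (by rintro _ ⟨x, -, rfl⟩; exact x.2)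
  let j : D i → (⋃ i, D i : Set X) := Set.inclusion (Set.subset_iUnion D i)
  have hj : Topology.IsEmbedding j := Topology.IsEmbedding.inclusion _
  have hsub : ∀ a, (p a : Set (⋃ i, D i : Set X)) ⊆ Set.range j := by
    intro a x hx
    have : x ∈ (p.last : Set (⋃ i, D i : Set X)) := (p.monotone (Fin.le_last a)) hx
    exact ⟨⟨x, hi ⟨x, this, rfl⟩⟩, rfl⟩
  let q : LTSeries (IrreducibleCloseds (D i)) :=
    { length := p.length
      toFun := fun a => ⟨j ⁻¹' (p a), isIrreducible_preimage hj (p a).isIrreducible (hsub a),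
        (p a).isClosed.preimage hj.continuous⟩
      step := fun a => by
        have h : p a.castSucc < p a.succ := p.step a
        refine lt_of_le_of_ne (show j ⁻¹' (p a.castSucc) ⊆ j ⁻¹' (p a.succ) from
          fun x hx => h.le hx) fun he => h.ne ?_
        have he' : j ⁻¹' (p a.castSucc) = j ⁻¹' (p a.succ) := congrArg (fun s => (s : Set (D i))) he
        refine SetLike.coe_injective ?_
        rw [← Set.image_preimage_eq_of_subset (hsub a.castSucc), he',
          Set.image_preimage_eq_of_subset (hsub a.succ)] }
  exact (le_iSup (fun q : LTSeries (IrreducibleCloseds (D i)) => (q.length : WithBot ℕ∞)) q).trans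
    (hm i)

end Topology

namespace GVariety

variable {k : Type u} [Field k] {G : Type v} [Group G] {d : ℕ}

lemma act_mul_apply (V : GVariety k G d) (g h : G) (x : V.carrier) :
    (V.act (g * h)) x = (V.act g) ((V.act h) x) := by
  rw [V.act_mul, Scheme.Hom.comp_apply]

lemma act_one_apply (V : GVariety k G d) (x : V.carrier) : (V.act 1) x = x := by
  rw [V.act_one]; rfl

lemma isHomeomorph_act (V : GVariety k G d) (g : G) : IsHomeomorph (V.act g) :=
  (V.actIso g).hom.homeomorph.isHomeomorph

lemma noetherianSpace (V : GVariety k G d) : NoetherianSpace V.carrier := by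
  have := V.locallyOfFiniteType
  have := V.quasiCompact
  have := LocallyOfFiniteType.isLocallyNoetherian V.str
  have : CompactSpace V.carrier := QuasiCompact.compactSpace_of_compactSpace V.str
  have : IsNoetherian V.carrier := {}
  infer_instance

/-- The union of the `G`-translates of a set `D` of points of a `G`-variety. -/
def orbit (V : GVariety k G d) (D : Set V.carrier) : Set V.carrier :=
  ⋃ g : G, V.act g '' D

lemma image_orbit (V : GVariety k G d) (D : Set V.carrier) (g : G) :
    V.act g '' V.orbit D = V.orbit D := by
  have key : ∀ g, V.act g '' V.orbit D ⊆ V.orbit D := by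
    rintro g _ ⟨x, hx, rfl⟩
    obtain ⟨h, y, hy, rfl⟩ := Set.mem_iUnion.mp hx
    exact Set.mem_iUnion.mpr ⟨g * h, y, hy, V.act_mul_apply g h y⟩
  refine (key g).antisymm fun x hx => ⟨(V.act g⁻¹) x, key _ ⟨x, hx, rfl⟩, ?_⟩
  rw [← act_mul_apply, mul_inv_cancel, act_one_apply]

/-- The set of `G`-orbits of divisorial (that is, of codimension one) components of the exceptional
locus of a birational map; an orbit of components is identified with the union of its members. -/
def exceptionalOrbits {m : ℕ} {V W : GVariety k G (m + 1)}
    (φ : V.carrier.PartialIso W.carrier) : Set (Set V.carrier) :=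
  V.orbit '' componentsOfDim (exceptionalLocus φ) m

lemma finite_exceptionalOrbits {m : ℕ} {V W : GVariety k G (m + 1)}
    (φ : V.carrier.PartialIso W.carrier) : (exceptionalOrbits φ).Finite :=
  have := V.noetherianSpace
  (finite_componentsOfDim (isClosed_exceptionalLocus φ) m).image _

/-- The generic stabilizer of (the components of) the orbit `E` is trivial: the locus with trivial
stabilizer is nonempty. -/
def HasTrivialGenericStabilizer (V : GVariety k G d) (E : Set V.carrier) : Prop :=
  ∃ x ∈ E, IsClosed {x} ∧ ∀ g ≠ 1, (V.act g) x ≠ x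

/-- `E` is the orbit of an `m`-dimensional irreducible closed subset. -/
def IsOrbitOfDim (V : GVariety k G d) (m : ℕ) (E : Set V.carrier) : Prop :=
  ∃ D : Set V.carrier, IsClosed D ∧ IsIrreducible D ∧ topologicalKrullDim D = m ∧ E = V.orbit D

lemma isOrbitOfDim_of_mem {m : ℕ} {V W : GVariety k G (m + 1)}
    {φ : V.carrier.PartialIso W.carrier} {E : Set V.carrier} (hE : E ∈ exceptionalOrbits φ) :
    V.IsOrbitOfDim m E := by
  obtain ⟨D, hD, rfl⟩ := hE
  exact ⟨D, isClosed_of_mem_componentsOfDim (isClosed_exceptionalLocus φ) hD, hD.1.1.1, hD.2, rfl⟩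

section

variable {V : GVariety k G d} {m : ℕ} {E : Set V.carrier}

lemma IsOrbitOfDim.isClosed [Finite G] (h : V.IsOrbitOfDim m E) : IsClosed E := by
  obtain ⟨D, hD, -, -, rfl⟩ := h
  exact isClosed_iUnion_of_finite fun g => (V.isHomeomorph_act g).isClosedMap _ hD

lemma IsOrbitOfDim.image_act (h : V.IsOrbitOfDim m E) (g : G) : V.act g '' E = E := by
  obtain ⟨D, -, -, -, rfl⟩ := h
  exact V.image_orbit D g

end

end GVariety

/-! ### Reduced closed subschemes -/

/-- The closed subset `Z` with its reduced induced scheme structure. -/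
abbrev reducedSubscheme {X : Scheme.{u}} (Z : Closeds X) : Scheme.{u} :=
  (Scheme.IdealSheafData.vanishingIdeal Z).subscheme

/-- The inclusion of the reduced closed subscheme on `Z`. -/
abbrev reducedSubschemeι {X : Scheme.{u}} (Z : Closeds X) : reducedSubscheme Z ⟶ X :=
  (Scheme.IdealSheafData.vanishingIdeal Z).subschemeι

lemma range_reducedSubschemeι {X : Scheme.{u}} (Z : Closeds X) :
    Set.range (reducedSubschemeι Z) = Z := by
  rw [Scheme.IdealSheafData.range_subschemeι, Scheme.IdealSheafData.coe_support_vanishingIdeal]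

instance {X : Scheme.{u}} (Z : Closeds X) : IsReduced (reducedSubscheme Z) := by
  let I := Scheme.IdealSheafData.vanishingIdeal Z
  have : ∀ U, IsReduced (I.subschemeCover.openCover.X U) := by
    intro U
    change IsReduced (Spec (CommRingCat.of (X.presheaf.obj (Opposite.op U.1) ⧸ I.ideal U)))
    have : (I.ideal U).IsRadical := PrimeSpectrum.isRadical_vanishingIdeal _
    have : _root_.IsReduced (X.presheaf.obj (Opposite.op U.1) ⧸ I.ideal U) :=
      (Ideal.isRadical_iff_quotient_reduced _).mp this
    have : _root_.IsReduced (CommRingCat.of (X.presheaf.obj (Opposite.op U.1) ⧸ I.ideal U)) := this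
    infer_instance
  exact AlgebraicGeometry.IsReduced.of_openCover _ I.subschemeCover.openCover

/-- The restriction to `Z` of an endomorphism of the ambient scheme which maps `Z` to itself. -/
def restrictEnd {X : Scheme.{u}} (Z : Closeds X) (a : X ⟶ X) (ha : a '' (Z : Set X) ⊆ Z) :
    reducedSubscheme Z ⟶ reducedSubscheme Z :=
  IsClosedImmersion.lift (reducedSubschemeι Z) (reducedSubschemeι Z ≫ a) <| by
    rw [← Scheme.IdealSheafData.map_ker, reducedSubschemeι, Scheme.IdealSheafData.ker_subschemeι,
      Scheme.IdealSheafData.map_vanishingIdeal]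
    exact Scheme.IdealSheafData.vanishingIdeal_antimono (closure_minimal ha Z.isClosed)

lemma restrictEnd_ι {X : Scheme.{u}} (Z : Closeds X) (a : X ⟶ X) (ha : a '' (Z : Set X) ⊆ Z) :
    restrictEnd Z a ha ≫ reducedSubschemeι Z = reducedSubschemeι Z ≫ a :=
  IsClosedImmersion.lift_fac _ _ _

namespace GVariety

variable {k : Type u} [Field k] {G : Type v} [Group G] {d : ℕ}

/-- The action of `G` on a `G`-stable reduced closed subscheme. -/
def restrictAct (V : GVariety k G d) (Z : Closeds V.carrier)
    (hZ : ∀ g, V.act g '' (Z : Set V.carrier) = Z) (g : G) :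
    reducedSubscheme Z ⟶ reducedSubscheme Z :=
  restrictEnd Z (V.act g) (hZ g).subset

section

variable (V : GVariety k G d) (Z : Closeds V.carrier)
    (hZ : ∀ g, V.act g '' (Z : Set V.carrier) = Z)

lemma restrictAct_ι (g : G) :
    V.restrictAct Z hZ g ≫ reducedSubschemeι Z = reducedSubschemeι Z ≫ V.act g :=
  restrictEnd_ι _ _ _

lemma restrictAct_one : V.restrictAct Z hZ 1 = 𝟙 _ := by
  rw [← cancel_mono (reducedSubschemeι Z), restrictAct_ι, V.act_one, Category.id_comp,
    Category.comp_id]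

lemma restrictAct_mul (g h : G) :
    V.restrictAct Z hZ (g * h) = V.restrictAct Z hZ h ≫ V.restrictAct Z hZ g := by
  rw [← cancel_mono (reducedSubschemeι Z), restrictAct_ι, V.act_mul, Category.assoc,
    restrictAct_ι, ← Category.assoc, ← Category.assoc, restrictAct_ι]

lemma restrictAct_apply (g : G) (x : reducedSubscheme Z) :
    reducedSubschemeι Z (V.restrictAct Z hZ g x) = V.act g (reducedSubschemeι Z x) := by
  rw [← Scheme.Hom.comp_apply, restrictAct_ι, Scheme.Hom.comp_apply]

end

section

variable [Finite G] {V : GVariety k G d} {m : ℕ} {E : Set V.carrier}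

lemma topologicalKrullDim_of_isOrbitOfDim (hE : V.IsOrbitOfDim m E) :
    topologicalKrullDim (reducedSubscheme ⟨E, hE.isClosed⟩) = m := by
  have h₀ : topologicalKrullDim (reducedSubscheme ⟨E, hE.isClosed⟩) = topologicalKrullDim E := by
    let e := (reducedSubschemeι ⟨E, hE.isClosed⟩).isClosedEmbedding.isEmbedding.toHomeomorph
    rw [IsHomeomorph.topologicalKrullDim_eq e e.isHomeomorph, range_reducedSubschemeι]
    rfl
  rw [h₀]
  obtain ⟨D, hD, hDi, hDm, rfl⟩ := hE
  have hg : ∀ g, topologicalKrullDim (V.act g '' D) = m := by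
    intro g
    have e := (V.isHomeomorph_act g).homeomorph.image D
    rw [← hDm]
    exact (IsHomeomorph.topologicalKrullDim_eq _ e.isHomeomorph).symm
  refine le_antisymm ?_ ?_
  · exact topologicalKrullDim_iUnion_le
      (fun g => (V.isHomeomorph_act g).isClosedMap _ hD) fun g => (hg g).le
  · rw [← hg 1]
    exact (Topology.IsEmbedding.inclusion (Set.subset_iUnion (fun g => V.act g '' D) 1)
      ).isInducing.topologicalKrullDim_le

lemma transitive_of_isOrbitOfDim (hE : V.IsOrbitOfDim m E) :
    ∀ C ∈ irreducibleComponents (reducedSubscheme ⟨E, hE.isClosed⟩),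
    ∀ C' ∈ irreducibleComponents (reducedSubscheme ⟨E, hE.isClosed⟩),
      ∃ g, (V.restrictAct ⟨E, hE.isClosed⟩ hE.image_act g) '' C = C' := by
  set Z : Closeds V.carrier := ⟨E, hE.isClosed⟩ with hZ
  have hemb := (reducedSubschemeι Z).isClosedEmbedding.isEmbedding
  have hrange : Set.range (reducedSubschemeι Z) = E := range_reducedSubschemeι Z
  have hact := hE.image_act
  have hE' := hE
  obtain ⟨D, hD, hDi, -, hED⟩ := hE'
  have hsub : ∀ g, V.act g '' D ⊆ Set.range (reducedSubschemeι Z) := by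
    intro g
    rw [hrange, hED]
    exact Set.subset_iUnion (fun g => V.act g '' D) g
  have key : ∀ C ∈ irreducibleComponents (reducedSubscheme Z),
      ∃ g, reducedSubschemeι Z '' C = V.act g '' D := by
    intro C hC
    obtain ⟨g, hg⟩ := exists_subset_of_isIrreducible (D := fun g => V.act g '' D)
      (fun g => (V.isHomeomorph_act g).isClosedMap _ hD)
      (hC.1.image _ hemb.continuous.continuousOn) (by
        rintro _ ⟨x, -, rfl⟩
        have : reducedSubschemeι Z x ∈ E := hrange ▸ Set.mem_range_self x
        rwa [hED] at this)
    refine ⟨g, hg.antisymm ?_⟩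
    have hirr : IsIrreducible (reducedSubschemeι Z ⁻¹' (V.act g '' D)) :=
      isIrreducible_preimage hemb
        (hDi.image _ (V.isHomeomorph_act g).continuous.continuousOn) (hsub g)
    have := hC.2 hirr (Set.image_subset_iff.mp hg)
    rw [← Set.image_preimage_eq_of_subset (hsub g)]
    exact Set.image_mono this
  intro C hC C' hC'
  obtain ⟨g, hg⟩ := key C hC
  obtain ⟨g', hg'⟩ := key C' hC'
  refine ⟨g' * g⁻¹, hemb.injective.image_injective ?_⟩
  have h₁ : reducedSubschemeι Z '' (V.restrictAct Z hact (g' * g⁻¹) '' C) =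
      V.act (g' * g⁻¹) '' (reducedSubschemeι Z '' C) := by
    rw [Set.image_image, Set.image_image]
    exact Set.image_congr fun x _ => V.restrictAct_apply Z hact _ x
  refine h₁.trans ?_
  rw [hg, hg', Set.image_image]
  refine Set.image_congr fun x _ => ?_
  rw [← act_mul_apply, inv_mul_cancel_right]

/-- The orbit `E` with trivial generic stabilizer, as a `G`-variety: the reduced closed subscheme
on `E` with the restricted action. -/
def orbitVariety (hE : V.IsOrbitOfDim m E) (hs : V.HasTrivialGenericStabilizer E) :
    GVariety k G m where
  carrier := reducedSubscheme ⟨E, hE.isClosed⟩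
  str := reducedSubschemeι _ ≫ V.str
  act := V.restrictAct ⟨E, hE.isClosed⟩ hE.image_act
  act_one := V.restrictAct_one _ _
  act_mul := V.restrictAct_mul _ _
  act_str g := by rw [← Category.assoc, restrictAct_ι, Category.assoc, V.act_str]
  isReduced := inferInstance
  isSeparated := have := V.isSeparated; inferInstance
  locallyOfFiniteType := have := V.locallyOfFiniteType; inferInstance
  quasiCompact := have := V.quasiCompact; inferInstance
  dim_eq := topologicalKrullDim_of_isOrbitOfDim hE
  transitive := transitive_of_isOrbitOfDim hE
  genericallyFree := by
    obtain ⟨x, hxE, hx, hfree⟩ := hs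
    obtain ⟨y, rfl⟩ : x ∈ Set.range (reducedSubschemeι ⟨E, hE.isClosed⟩) := by
      rw [range_reducedSubschemeι]; exact hxE
    have hemb := (reducedSubschemeι ⟨E, hE.isClosed⟩).isClosedEmbedding.isEmbedding
    refine ⟨y, ?_, fun g hg he => hfree g hg ?_⟩
    · have := hx.preimage hemb.continuous
      rwa [← Set.image_singleton, Set.preimage_image_eq _ hemb.injective] at this
    · rw [← restrictAct_apply _ _ hE.image_act, he]

open Classical in
/-- The sum, over the finitely many `G`-orbits `E` of divisorial components of the exceptional locus of `φ` with
trivial generic stabilizer, of the equivariant birational classes of `E`. -/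
def exceptionalClass {m : ℕ} {V W : GVariety k G (m + 1)}
    (φ : V.carrier.PartialIso W.carrier) : ZBir k G m :=
  ∑ E ∈ (finite_exceptionalOrbits φ).toFinset.attach,
    if hs : V.HasTrivialGenericStabilizer E.1 then
      FreeAbelianGroup.of (Quot.mk _ (orbitVariety
        (isOrbitOfDim_of_mem ((finite_exceptionalOrbits φ).mem_toFinset.mp E.2)) hs))
    else 0

/-- The invariant `C_G(φ)` of a birational map `φ : V ⇢ W`: the exceptional class of `φ⁻¹` (on `W`)
minus the exceptional class of `φ` (on `V`). -/
def invariantC {m : ℕ} {V W : GVariety k G (m + 1)}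
    (φ : V.carrier.PartialIso W.carrier) : ZBir k G m :=
  exceptionalClass φ.symm - exceptionalClass φ

end

end GVariety

end EquivBir

end

/-!
The invariant counts the divisorial orbits outside the locus where the map is an isomorphism, and
its additivity is a cancellation between such orbits.

Every equivariant birational map `p` has a representative whose source is the largest open set on
which it is an isomorphism onto an open set (`exists_isMaximal`; reducedness and separatedness
allow the representatives to be glued). This representative is equivariant on the nose: its source
is stable under `G`, and it commutes with the action (`IsEquivariantBirational.maps_act`).
Consequently, the exceptional orbits of `p` are the orbits of irreducible closed subsets of
codimension one not meeting the source of `p` (`mem_exceptionalOrbits_iff`).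

If such an orbit `E` does meet the source of `p`, then its strict transform (the closure of its
image) is again an orbit of a closed subset of codimension one, and `p` restricts to an equivariant
birational map between the two (`birational_strictTransform`). That the codimension is preserved
rests on the fact that nonempty open subsets of an irreducible scheme locally of finite type over a
field have full dimension (`topologicalKrullDim_inter_open`), which is deduced from the equality of
Krull dimension and transcendence degree for finitely generated domains. Triviality of the generic
stabilizer is preserved because over an algebraically closed field the closed points with trivial
stabilizer are the closed points of an open set. So `E` and its strict transform have the same
class (`orbitClass_strictTransform`), and taking strict transforms under `p⁻¹` is the inverse
operation.

Let `χ` be the composition of `φ : V ⇢ W` and `ψ : W ⇢ W'`, and let `Ex` be the set of exceptional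
orbits. By the above, strict transforms give class-preserving bijections
`Ex χ \ Ex φ ≃ Ex ψ \ Ex φ⁻¹` and, as `φ` is the composition of `χ` and `ψ⁻¹`,
`Ex φ \ Ex χ ≃ Ex ψ⁻¹ \ Ex χ⁻¹` (`orbitSum_exceptionalOrbits_diff`). Writing `S` for the sum of
the classes, it follows that
`S (Ex χ) = S (Ex φ) - S (Ex φ \ Ex χ) + S (Ex ψ) - S (Ex ψ ∩ Ex φ⁻¹)`
(`orbitSum_exceptionalOrbits_comp`). In the same formula for `χ⁻¹`, the composition of `ψ⁻¹` and
`φ⁻¹`, the two correction terms are `S (Ex ψ⁻¹ \ Ex χ⁻¹) = S (Ex φ \ Ex χ)` and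
`S (Ex φ⁻¹ ∩ Ex ψ)`. They cancel in the difference. Resolution of singularities and the geometry
of smooth projective varieties play no role.
-/

noncomputable section

namespace EquivBir

/-! ### Dimension of finitely generated domains -/

/-- Chains of primes lift by going up, and distinct comparable primes of `S` lie over distinct
primes of `R`. -/
theorem ringKrullDim_eq_of_isIntegral {R S : Type*} [CommRing R] [CommRing S] [Algebra R S]
    [Algebra.IsIntegral R S] [FaithfulSMul R S] : ringKrullDim R = ringKrullDim S := by
  refine le_antisymm ?_ ?_
  · refine iSup_le fun l => ?_
    obtain ⟨⟨P, hP, hPl⟩⟩ := Ideal.nonempty_primesOver (S := S) l.head.asIdeal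
    obtain ⟨L, hL, -⟩ := Ideal.exists_ltSeries_of_hasGoingUp l P
    rw [← hL]
    exact le_iSup (fun p : LTSeries (PrimeSpectrum S) => (p.length : WithBot ℕ∞)) L
  · refine Order.krullDim_le_of_strictMono (PrimeSpectrum.comap (algebraMap R S)) fun I J h => ?_
    exact Ideal.IsIntegral.comap_lt_comap (R := R) (show I.asIdeal < J.asIdeal from h)

/-- Noether normalization reduces this to polynomial rings. -/
theorem ringKrullDim_eq_toENat_trdeg (k A : Type*) [Field k] [CommRing A] [IsDomain A]
    [Algebra k A] [Algebra.FiniteType k A] :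
    ringKrullDim A = Cardinal.toENat (Algebra.trdeg k A) := by
  obtain ⟨s, g, hg, hint⟩ := exists_integral_inj_algHom_of_fg k A
  algebraize [g.toRingHom]
  have : FaithfulSMul (MvPolynomial (Fin s) k) A :=
    (faithfulSMul_iff_algebraMap_injective _ _).mpr hg
  have : Algebra.IsIntegral (MvPolynomial (Fin s) k) A := ⟨hint⟩
  have : IsScalarTower k (MvPolynomial (Fin s) k) A := .of_algebraMap_eq' g.comp_algebraMap.symm
  rw [← ringKrullDim_eq_of_isIntegral (R := MvPolynomial (Fin s) k),
    MvPolynomial.ringKrullDim_of_isNoetherianRing, ringKrullDim_eq_zero_of_field]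
  have := lift_trdeg_add_eq k (MvPolynomial (Fin s) k) A
  rw [trdeg_eq_zero (R := MvPolynomial (Fin s) k), MvPolynomial.trdeg_of_isDomain] at this
  have := congrArg Cardinal.toENat this
  simp at this
  rw [← this]
  simp

/-- Localizing a finitely generated domain at a nonzero element does not change the fraction field,
hence not the transcendence degree. -/
theorem ringKrullDim_away {k A B : Type*} [Field k] [CommRing A] [IsDomain A] [Algebra k A]
    [Algebra.FiniteType k A] {f : A} (hf : f ≠ 0) [CommRing B] [Algebra A B]
    [IsLocalization.Away f B] : ringKrullDim B = ringKrullDim A := by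
  algebraize [(algebraMap A B).comp (algebraMap k A)]
  have hM : Submonoid.powers f ≤ nonZeroDivisors A :=
    powers_le_nonZeroDivisors_of_noZeroDivisors hf
  have : IsDomain B := IsLocalization.isDomain_of_le_nonZeroDivisors B hM
  have : FaithfulSMul A B :=
    (faithfulSMul_iff_algebraMap_injective _ _).mpr (IsLocalization.injective B hM)
  have : Algebra.FiniteType A B := IsLocalization.finiteType_of_monoid_fg (.powers f) B
  have : Algebra.FiniteType k B := .trans (S := A) inferInstance inferInstance
  have : Algebra.IsAlgebraic A B := IsLocalization.isAlgebraic B (.powers f)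
  rw [ringKrullDim_eq_toENat_trdeg k A, ringKrullDim_eq_toENat_trdeg k B]
  have := lift_trdeg_add_eq k A B
  rw [trdeg_eq_zero (R := A)] at this
  have := congrArg Cardinal.toENat this
  simp at this
  rw [← this]

/-! ### Dimension of open subsets of irreducible closed subsets -/

lemma topologicalKrullDim_affineOpen {Z : Scheme.{u}} {W : Z.Opens} (hW : IsAffineOpen W) :
    topologicalKrullDim W = ringKrullDim Γ(Z, W) := by
  rw [← PrimeSpectrum.topologicalKrullDim_eq_ringKrullDim]
  exact IsHomeomorph.topologicalKrullDim_eq _ hW.isoSpec.hom.homeomorph.isHomeomorph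

/-- A chain of irreducible closed subsets restricts to a chain of the same length in any open set
meeting its smallest member. -/
lemma exists_length_le_topologicalKrullDim_open {X : Type*} [TopologicalSpace X]
    (p : LTSeries (IrreducibleCloseds X)) {W : Opens X} {x : X}
    (hx : x ∈ p.head) (hW : x ∈ W) : (p.length : WithBot ℕ∞) ≤ topologicalKrullDim W := by
  let e := IrreducibleCloseds.orderIsoOfIsOpenEmbedding _ W.isOpen.isOpenEmbedding_subtypeVal
  let q : LTSeries (IrreducibleCloseds W) :=
    { length := p.length
      toFun := fun a => e.symm ⟨p a, ⟨⟨x, hW⟩, p.monotone (Fin.zero_le a) hx⟩⟩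
      step := fun a => e.symm.strictMono (p.step a) }
  exact le_iSup (fun q : LTSeries (IrreducibleCloseds W) => (q.length : WithBot ℕ∞)) q

/-- A chain of irreducible closed subsets of `Z` is visible in an affine open set around a point of
its smallest member, and the dimension of an affine open set does not change when it is shrunk to a
nonempty basic open set. -/
lemma topologicalKrullDim_opens_of_isIntegral {k : Type u} [Field k] {Z : Scheme.{u}}
    [IsIntegral Z] (s : Z ⟶ Spec (.of k)) [LocallyOfFiniteType s] (U : Z.Opens)
    (hU : (U : Set Z).Nonempty) : topologicalKrullDim U = topologicalKrullDim Z := by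
  refine le_antisymm (topologicalKrullDim_subspace_le _ _) (iSup_le fun p => ?_)
  obtain ⟨x, hx⟩ := p.head.isIrreducible.nonempty
  obtain ⟨W, hW, hxW, -⟩ := exists_isAffineOpen_mem_and_subset (X := Z) (U := ⊤) (x := x) trivial
  refine (exists_length_le_topologicalKrullDim_open p hx hxW).trans ?_
  obtain ⟨y, hyW, hyU⟩ := nonempty_preirreducible_inter W.isOpen U.isOpen ⟨x, hxW⟩ hU
  obtain ⟨f, hfU, hyf⟩ := hW.exists_basicOpen_le ⟨y, hyU⟩ hyW
  have hle : topologicalKrullDim (Z.basicOpen f) ≤ topologicalKrullDim U :=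
    (Topology.IsEmbedding.inclusion hfU).isInducing.topologicalKrullDim_le
  refine le_trans (le_of_eq ?_) hle
  refine (topologicalKrullDim_affineOpen hW).trans
    (.trans ?_ (topologicalKrullDim_affineOpen (hW.basicOpen f)).symm)
  have : Nonempty W := ⟨⟨x, hxW⟩⟩
  have hft := ((s.finiteType_appLE (isAffineOpen_top _) hW le_top).comp
    (RingHom.FiniteType.of_surjective (Scheme.ΓSpecIso (.of k)).inv.hom
      (ConcreteCategory.bijective_of_isIso (Scheme.ΓSpecIso (.of k)).inv).2))
  algebraize [(s.appLE ⊤ W le_top).hom.comp (Scheme.ΓSpecIso (.of k)).inv.hom]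
  have : Algebra.FiniteType k Γ(Z, W) := hft
  have := hW.isLocalization_basicOpen f
  refine (ringKrullDim_away (k := k) (f := f) ?_).symm
  rintro rfl
  simp at hyf

/-- A nonempty open part of an irreducible closed subset has the same dimension; the irreducible
closed subset is given its reduced structure, and is then integral. -/
lemma topologicalKrullDim_inter_open {k : Type u} [Field k] {X : Scheme.{u}}
    (s : X ⟶ Spec (.of k)) [LocallyOfFiniteType s] {D : Set X} (hD : IsClosed D)
    (hDi : IsIrreducible D) (U : X.Opens) (hU : (D ∩ U).Nonempty) :
    topologicalKrullDim (D ∩ U : Set X) = topologicalKrullDim D := by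
  let Z : Closeds X := ⟨D, hD⟩
  have hemb := (reducedSubschemeι Z).isClosedEmbedding.isEmbedding
  have hrange : Set.range (reducedSubschemeι Z) = D := range_reducedSubschemeι Z
  have hirr : IrreducibleSpace (reducedSubscheme Z) := by
    have := isIrreducible_preimage hemb hDi hrange.ge
    rw [← hrange, Set.preimage_range] at this
    exact (irreducibleSpace_def _).mpr this
  have := isIntegral_of_irreducibleSpace_of_isReduced (reducedSubscheme Z)
  obtain ⟨x, hxD, hxU⟩ := hU
  obtain ⟨y, rfl⟩ := hrange.ge hxD
  have key := topologicalKrullDim_opens_of_isIntegral (reducedSubschemeι Z ≫ s)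
    (reducedSubschemeι Z ⁻¹ᵁ U) ⟨y, hxU⟩
  have himg : ∀ T : Set (reducedSubscheme Z), topologicalKrullDim T =
      topologicalKrullDim (reducedSubschemeι Z '' T) := fun T =>
    IsHomeomorph.topologicalKrullDim_eq _ (hemb.homeomorphImage T).isHomeomorph
  have h1 := himg (reducedSubschemeι Z ⁻¹' U)
  rw [Set.image_preimage_eq_inter_range, hrange, Set.inter_comm] at h1
  rw [← h1]
  refine key.trans ?_
  rw [IsHomeomorph.topologicalKrullDim_eq _ hemb.toHomeomorph.isHomeomorph, hrange]

/-! ### Partial isomorphisms acting on `T`-valued points and on points -/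

section PartialIso

variable {X Y Z T : Scheme.{u}}

/-- `MapsOpens e a b`: the isomorphism `e` between the open subschemes `U` and `V` maps the
`T`-valued point `a` to the `T`-valued point `b`, that is, `a` factors through `U` and composing
with `e` gives `b`. -/
def MapsOpens {U : X.Opens} {V : Y.Opens} (e : U.toScheme ≅ V.toScheme) (a : T ⟶ X) (b : T ⟶ Y) :
    Prop :=
  ∃ c : T ⟶ U, c ≫ U.ι = a ∧ c ≫ e.hom ≫ V.ι = b

/-- The partial isomorphism `p` maps the `T`-valued point `a` of `X` to the `T`-valued point `b` of
`Y`. -/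
def Maps (p : X.PartialIso Y) (a : T ⟶ X) (b : T ⟶ Y) : Prop :=
  MapsOpens p.iso a b

lemma MapsOpens.symm {U : X.Opens} {V : Y.Opens} {e : U.toScheme ≅ V.toScheme} {a : T ⟶ X}
    {b : T ⟶ Y} (h : MapsOpens e a b) : MapsOpens e.symm b a := by
  obtain ⟨c, rfl, rfl⟩ := h
  exact ⟨c ≫ e.hom, by simp, by simp⟩

lemma Maps.symm {p : X.PartialIso Y} {a : T ⟶ X} {b : T ⟶ Y} (h : Maps p a b) :
    Maps p.symm b a :=
  MapsOpens.symm h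

lemma Maps.comp {p : X.PartialIso Y} {a : T ⟶ X} {b : T ⟶ Y} (h : Maps p a b) {T' : Scheme.{u}}
    (t : T' ⟶ T) : Maps p (t ≫ a) (t ≫ b) := by
  obtain ⟨c, rfl, rfl⟩ := h
  exact ⟨t ≫ c, by simp, by simp⟩

lemma Maps.unique {p : X.PartialIso Y} {a : T ⟶ X} {b b' : T ⟶ Y} (h : Maps p a b)
    (h' : Maps p a b') : b = b' := by
  obtain ⟨c, rfl, rfl⟩ := h
  obtain ⟨c', hc', rfl⟩ := h'
  rw [(cancel_mono _).mp hc']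

lemma Maps.range_subset {p : X.PartialIso Y} {a : T ⟶ X} {b : T ⟶ Y} (h : Maps p a b) :
    Set.range a ⊆ p.source := by
  obtain ⟨c, rfl, rfl⟩ := h
  rintro _ ⟨x, rfl⟩
  exact (c x).2

lemma exists_maps (p : X.PartialIso Y) (a : T ⟶ X) (h : Set.range a ⊆ p.source) :
    ∃ b, Maps p a b :=
  ⟨_, IsOpenImmersion.lift p.source.ι a (by simpa using h), IsOpenImmersion.lift_fac _ _ _, rfl⟩

lemma maps_source (p : X.PartialIso Y) : Maps p p.source.ι (p.iso.hom ≫ p.target.ι) :=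
  ⟨𝟙 _, by simp, by simp⟩

lemma mapsOpens_top (e : X ≅ Y) (a : T ⟶ X) :
    MapsOpens (X.topIso ≪≫ e ≪≫ Y.topIso.symm) a (a ≫ e.hom) :=
  ⟨a ≫ X.topIso.inv, by simp, by simp⟩

lemma maps_ofIso (e : X ≅ Y) (a : T ⟶ X) : Maps (.ofIso e) a (a ≫ e.hom) :=
  mapsOpens_top e a

lemma MapsOpens.of_restrict {U : X.Opens} {V : Y.Opens} {e : U.toScheme ≅ V.toScheme}
    {U' : X.Opens} (hU' : U' ≤ U) {a : T ⟶ X} {b : T ⟶ Y}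
    (h : MapsOpens ((Scheme.Opens.isoOfLE hU').symm ≪≫ (e.hom.isoImage (U.ι ⁻¹ᵁ U')) ≪≫
      (V.ι.isoImage (e.hom ''ᵁ U.ι ⁻¹ᵁ U'))) a b) : MapsOpens e a b := by
  obtain ⟨c, rfl, rfl⟩ := h
  have h : (Scheme.Opens.isoOfLE hU').inv ≫ (U.ι ⁻¹ᵁ U').ι = X.homOfLE hU' := by
    rw [← cancel_mono U.ι]; simp
  exact ⟨c ≫ X.homOfLE hU', by simp, by simp [← h]⟩

lemma maps_restrictSource_iff {p : X.PartialIso Y} {U : Opens X} {hU : Dense (U : Set X)}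
    {hU' : U ≤ p.source} {a : T ⟶ X} {b : T ⟶ Y} :
    Maps (p.restrictSource U hU hU') a b ↔ Maps p a b ∧ Set.range a ⊆ U := by
  constructor
  · intro h
    exact ⟨MapsOpens.of_restrict hU' h, h.range_subset⟩
  · rintro ⟨h, hr⟩
    obtain ⟨b', hb'⟩ := exists_maps (p.restrictSource U hU hU') a hr
    have : Maps p a b' := MapsOpens.of_restrict hU' hb'
    rwa [h.unique this]

lemma mapsOpens_trans_iff {U : X.Opens} {V : Y.Opens} {W : Z.Opens} {e : U.toScheme ≅ V.toScheme}
    {f : V.toScheme ≅ W.toScheme} {a : T ⟶ X} {c : T ⟶ Z} :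
    MapsOpens (e ≪≫ Y.isoOfEq rfl ≪≫ f) a c ↔ ∃ b, MapsOpens e a b ∧ MapsOpens f b c := by
  constructor
  · rintro ⟨t, rfl, rfl⟩
    exact ⟨_, ⟨t, rfl, rfl⟩, ⟨t ≫ e.hom, by simp, by simp⟩⟩
  · rintro ⟨b, ⟨t, rfl, rfl⟩, ⟨s, hs, rfl⟩⟩
    have : s = t ≫ e.hom := by
      rw [← cancel_mono V.ι, hs, Category.assoc]
    subst this
    exact ⟨t, rfl, by simp⟩

lemma maps_trans_iff {p : X.PartialIso Y} {q : Y.PartialIso Z} {a : T ⟶ X} {c : T ⟶ Z} :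
    Maps (p.trans q) a c ↔ ∃ b, Maps p a b ∧ Maps q b c := by
  have hd : Dense ((p.target ⊓ q.source : Y.Opens) : Set Y) :=
    p.dense_target.inter_of_isOpen_right q.dense_source q.source.2
  have key : Maps (p.trans q) a c ↔ ∃ b, Maps (p.restrictTarget _ hd inf_le_left) a b ∧
      Maps (q.restrictSource _ hd inf_le_right) b c := mapsOpens_trans_iff
  rw [key]
  constructor
  · rintro ⟨b, hb, hc⟩
    exact ⟨b, (maps_restrictSource_iff.mp hb.symm).1.symm, (maps_restrictSource_iff.mp hc).1⟩
  · rintro ⟨b, hb, hc⟩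
    have hr : Set.range b ⊆ ((p.target ⊓ q.source : Y.Opens) : Set Y) :=
      Set.subset_inter hb.symm.range_subset hc.range_subset
    exact ⟨b, (maps_restrictSource_iff (p := p.symm).mpr ⟨hb.symm, hr⟩).symm,
      maps_restrictSource_iff.mpr ⟨hc, hr⟩⟩

lemma Maps.isOpenImmersion {p : X.PartialIso Y} {a : T ⟶ X} {b : T ⟶ Y} (h : Maps p a b)
    [IsOpenImmersion a] : IsOpenImmersion b := by
  obtain ⟨c, rfl, rfl⟩ := h
  have : IsOpenImmersion c := .of_comp c p.source.ι
  infer_instance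

lemma Maps.isDominant {p : X.PartialIso Y} {a : T ⟶ X} {b : T ⟶ Y} (h : Maps p a b)
    [IsDominant a] : IsDominant b := by
  obtain ⟨c, rfl, rfl⟩ := h
  have : IsDominant c := by
    refine ⟨?_⟩
    have h1 : Dense (Set.range (c ≫ p.source.ι)) := (c ≫ p.source.ι).denseRange
    have h2 := h1.preimage p.source.ι.isOpenEmbedding.isOpenMap
    have h3 : Set.range c = p.source.ι ⁻¹' Set.range (c ≫ p.source.ι) := by
      ext x
      refine ⟨fun ⟨y, hy⟩ => ⟨y, by rw [Scheme.Hom.comp_apply, hy]⟩, fun ⟨y, hy⟩ => ⟨y, ?_⟩⟩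
      rw [Scheme.Hom.comp_apply] at hy
      exact p.source.ι.isOpenEmbedding.injective hy
    exact (h3 ▸ h2 : Dense (Set.range c))
  have := Opens.isDominant_ι p.dense_target
  infer_instance

/-- Two partial isomorphisms define the same rational map if and only if they agree on a dense
open subscheme. -/
lemma toRationalMap_eq_iff {p q : X.PartialIso Y} : p.toRationalMap = q.toRationalMap ↔
    ∃ (T : Scheme.{u}) (a : T ⟶ X) (b : T ⟶ Y), IsOpenImmersion a ∧ IsDominant a ∧
      Maps p a b ∧ Maps q a b := by
  rw [Scheme.PartialMap.toRationalMap_eq_iff]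
  constructor
  · rintro ⟨W, hW, hp, hq, h⟩
    have hp' : W ≤ p.source := hp
    have hq' : W ≤ q.source := hq
    exact ⟨W, W.ι, _, inferInstance, Opens.isDominant_ι hW,
      ⟨X.homOfLE hp', X.homOfLE_ι hp', rfl⟩, ⟨X.homOfLE hq', X.homOfLE_ι hq', h.symm⟩⟩
  · rintro ⟨T, a, b, ha, hd, hp, hq⟩
    refine ⟨a.opensRange, a.denseRange, hp.range_subset, hq.range_subset, ?_⟩
    have hp' : Maps p a.opensRange.ι
        (X.homOfLE hp.range_subset ≫ p.iso.hom ≫ p.target.ι) := ⟨_, X.homOfLE_ι _, rfl⟩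
    have hq' : Maps q a.opensRange.ι
        (X.homOfLE hq.range_subset ≫ q.iso.hom ≫ q.target.ι) := ⟨_, X.homOfLE_ι _, rfl⟩
    have e : a.isoOpensRange.inv ≫ a = a.opensRange.ι := by simp
    exact (hp'.unique (e ▸ hp.comp a.isoOpensRange.inv)).trans
      ((e ▸ hq.comp a.isoOpensRange.inv).unique hq')

lemma toRationalMap_symm_congr {p q : X.PartialIso Y} (h : p.toRationalMap = q.toRationalMap) :
    p.symm.toRationalMap = q.symm.toRationalMap := by
  obtain ⟨T, a, b, ha, hd, hp, hq⟩ := toRationalMap_eq_iff.mp h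
  exact toRationalMap_eq_iff.mpr
    ⟨T, b, a, hp.isOpenImmersion, hp.isDominant, hp.symm, hq.symm⟩

lemma isDominant_pullback_fst (a : T ⟶ X) [IsOpenImmersion a] [IsDominant a] (f : Z ⟶ X)
    [IsOpenImmersion f] : IsDominant (Limits.pullback.fst f a) := by
  refine ⟨?_⟩
  have : Set.range (Limits.pullback.fst f a) = f ⁻¹' (Set.range a) :=
    IsOpenImmersion.range_pullbackFst a f
  rw [DenseRange, this]
  exact a.denseRange.preimage f.isOpenEmbedding.isOpenMap

lemma toRationalMap_trans_congr {p p' : X.PartialIso Y} {q q' : Y.PartialIso Z}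
    (hp : p.toRationalMap = p'.toRationalMap) (hq : q.toRationalMap = q'.toRationalMap) :
    (p.trans q).toRationalMap = (p'.trans q').toRationalMap := by
  obtain ⟨T, a, b, ha, hd, h1, h2⟩ := toRationalMap_eq_iff.mp hp
  obtain ⟨S, c, d, hc, hd', h3, h4⟩ := toRationalMap_eq_iff.mp hq
  have := h1.isOpenImmersion
  have := isDominant_pullback_fst c b
  refine toRationalMap_eq_iff.mpr ⟨_, Limits.pullback.fst b c ≫ a, Limits.pullback.snd b c ≫ d,
    inferInstance, inferInstance, ?_, ?_⟩
  · refine maps_trans_iff.mpr ⟨_, h1.comp _, ?_⟩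
    rw [Limits.pullback.condition]
    exact h3.comp _
  · refine maps_trans_iff.mpr ⟨_, h2.comp _, ?_⟩
    rw [Limits.pullback.condition]
    exact h4.comp _

lemma symm_trans_toRationalMap (p : X.PartialIso Y) (q : Y.PartialIso Z) :
    (p.trans q).symm.toRationalMap = (q.symm.trans p.symm).toRationalMap := by
  have h := (maps_source (p.trans q)).symm
  have hd : IsDominant ((p.trans q).source.ι) := Opens.isDominant_ι (p.trans q).dense_source
  refine toRationalMap_eq_iff.mpr ⟨_, _, _, (maps_source (p.trans q)).isOpenImmersion,
    (maps_source (p.trans q)).isDominant, h, ?_⟩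
  obtain ⟨b, hb, hc⟩ := maps_trans_iff.mp (maps_source (p.trans q))
  exact maps_trans_iff.mpr ⟨b, hc.symm, hb.symm⟩

lemma symm_trans_cancel_toRationalMap (p : X.PartialIso Y) (q : Y.PartialIso Z) :
    ((p.trans q).trans q.symm).toRationalMap = p.toRationalMap := by
  have h := maps_source (p.trans q)
  have hd : IsDominant ((p.trans q).source.ι) := Opens.isDominant_ι (p.trans q).dense_source
  obtain ⟨b, hb, hc⟩ := maps_trans_iff.mp h
  exact toRationalMap_eq_iff.mpr ⟨_, _, _, inferInstance, hd,
    maps_trans_iff.mpr ⟨_, h, hc.symm⟩, hb⟩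

/-- On a reduced source and with separated target, representatives of the same
rational map agree wherever both are defined. -/
lemma Maps.unique_of_toRationalMap_eq [IsReduced X] [Y.IsSeparated] {p q : X.PartialIso Y}
    (h : p.toRationalMap = q.toRationalMap) {a : T ⟶ X} {b b' : T ⟶ Y} (hb : Maps p a b)
    (hb' : Maps q a b') : b = b' := by
  obtain ⟨S, s, t, hs, hd, hp, hq⟩ := toRationalMap_eq_iff.mp h
  let W := p.source ⊓ q.source
  obtain ⟨c, hc⟩ := exists_maps p W.ι (by simp [W])
  obtain ⟨c', hc'⟩ := exists_maps q W.ι (by simp [W])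
  have hcc : c = c' := by
    have := isDominant_pullback_fst s W.ι
    refine ext_of_isDominant (Limits.pullback.fst W.ι s) ?_
    have h1 := hc.comp (Limits.pullback.fst W.ι s)
    have h2 := hc'.comp (Limits.pullback.fst W.ι s)
    rw [Limits.pullback.condition] at h1 h2
    exact (h1.unique (hp.comp _)).trans ((hq.comp _).unique h2)
  have hr : Set.range a ⊆ Set.range W.ι := by
    simpa [W] using ⟨hb.range_subset, hb'.range_subset⟩
  obtain ⟨l, rfl⟩ : ∃ l, l ≫ W.ι = a :=
    ⟨IsOpenImmersion.lift W.ι a hr, IsOpenImmersion.lift_fac _ _ _⟩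
  rw [hb.unique (hc.comp l), hb'.unique (hc'.comp l), hcc]

/-- The partial isomorphism `p` is defined at the point `x` and maps it to `y`. -/
def MapsPt (p : X.PartialIso Y) (x : X) (y : Y) : Prop :=
  ∃ z : p.source.toScheme, p.source.ι z = x ∧ (p.iso.hom ≫ p.target.ι) z = y

lemma Maps.mapsPt {p : X.PartialIso Y} {a : T ⟶ X} {b : T ⟶ Y} (h : Maps p a b) (t : T) :
    MapsPt p (a t) (b t) := by
  obtain ⟨c, rfl, rfl⟩ := h
  exact ⟨c t, by simp only [Scheme.Hom.comp_apply], by simp only [Scheme.Hom.comp_apply]⟩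

lemma MapsPt.mem_source {p : X.PartialIso Y} {x : X} {y : Y} (h : MapsPt p x y) :
    x ∈ p.source := by
  obtain ⟨z, rfl, -⟩ := h
  exact z.2

lemma exists_ι_eq {U : X.Opens} {x : X} (hx : x ∈ U) : ∃ z : U.toScheme, U.ι z = x :=
  ⟨⟨x, hx⟩, rfl⟩

lemma exists_mapsPt {p : X.PartialIso Y} {x : X} (hx : x ∈ p.source) : ∃ y, MapsPt p x y := by
  obtain ⟨z, hz⟩ := exists_ι_eq hx
  exact ⟨_, z, hz, rfl⟩

lemma MapsPt.symm {p : X.PartialIso Y} {x : X} {y : Y} (h : MapsPt p x y) :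
    MapsPt p.symm y x := by
  obtain ⟨z, rfl, rfl⟩ := h
  exact (maps_source p).symm.mapsPt z

lemma MapsPt.unique {p : X.PartialIso Y} {x : X} {y y' : Y} (h : MapsPt p x y)
    (h' : MapsPt p x y') : y = y' := by
  obtain ⟨z, rfl, rfl⟩ := h
  obtain ⟨z', hz', rfl⟩ := h'
  rw [p.source.ι.isOpenEmbedding.injective hz']

lemma MapsPt.injective {p : X.PartialIso Y} {x x' : X} {y : Y} (h : MapsPt p x y)
    (h' : MapsPt p x' y) : x = x' :=
  h.symm.unique h'.symm

lemma MapsPt.unique_of_toRationalMap_eq [IsReduced X] [Y.IsSeparated] {p q : X.PartialIso Y}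
    (h : p.toRationalMap = q.toRationalMap) {x : X} {y y' : Y} (hy : MapsPt p x y)
    (hy' : MapsPt q x y') : y = y' := by
  obtain ⟨b, hb⟩ := exists_maps p (p.source ⊓ q.source).ι (by simp)
  obtain ⟨b', hb'⟩ := exists_maps q (p.source ⊓ q.source).ι (by simp)
  have := hb.unique_of_toRationalMap_eq h hb'
  subst this
  obtain ⟨z, rfl⟩ : ∃ z : (p.source ⊓ q.source).toScheme, (p.source ⊓ q.source).ι z = x :=
    exists_ι_eq ⟨hy.mem_source, hy'.mem_source⟩
  exact (hy.unique (hb.mapsPt z)).trans ((hb'.mapsPt z).unique hy')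

lemma mapsPt_trans_iff {p : X.PartialIso Y} {q : Y.PartialIso Z} {x : X} {z : Z} :
    MapsPt (p.trans q) x z ↔ ∃ y, MapsPt p x y ∧ MapsPt q y z := by
  constructor
  · rintro ⟨t, rfl, rfl⟩
    obtain ⟨b, hb, hc⟩ := maps_trans_iff.mp (maps_source (p.trans q))
    exact ⟨b t, hb.mapsPt t, hc.mapsPt t⟩
  · rintro ⟨y, hxy, hyz⟩
    let W := p.target ⊓ q.source
    obtain ⟨a, ha⟩ := exists_maps p.symm W.ι (by simp [W, Scheme.PartialIso.symm])
    obtain ⟨c, hc⟩ := exists_maps q W.ι (by simp [W])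
    obtain ⟨w, rfl⟩ : ∃ w : W.toScheme, W.ι w = y :=
      exists_ι_eq ⟨hxy.symm.mem_source, hyz.mem_source⟩
    have h := (maps_trans_iff.mpr ⟨_, ha.symm, hc⟩ : Maps (p.trans q) a c).mapsPt w
    rwa [(ha.mapsPt w).unique hxy.symm, (hc.mapsPt w).unique hyz] at h

end PartialIso

/-! ### Maximal partial isomorphisms -/

section Maximal

variable {X Y Z T : Scheme.{u}}

/-- A partial isomorphism is maximal if its source contains the source of every partial isomorphism
defining the same rational map. -/
def IsMaximal (p : X.PartialIso Y) : Prop :=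
  ∀ q : X.PartialIso Y, q.toRationalMap = p.toRationalMap → q.source ≤ p.source

lemma exceptionalLocus_congr {p q : X.PartialIso Y} (h : p.toRationalMap = q.toRationalMap) :
    exceptionalLocus p = exceptionalLocus q := by
  unfold exceptionalLocus
  rw [h]

lemma IsMaximal.exceptionalLocus_eq {p : X.PartialIso Y} (hp : IsMaximal p) :
    exceptionalLocus p = (p.source : Set X)ᶜ := by
  ext x
  exact ⟨fun h => h p rfl, fun h q hq hx => h (hp q hq hx)⟩

/-- The representatives of a rational map are restrictions of a single morphism on the complement of
the exceptional locus. -/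
lemma exists_hom_of_toRationalMap_eq [IsReduced X] [Y.IsSeparated] (p : X.PartialIso Y) :
    ∃ (U : X.Opens) (f : U.toScheme ⟶ Y), (∀ x, x ∈ U ↔ x ∉ exceptionalLocus p) ∧
      ∀ q : X.PartialIso Y, q.toRationalMap = p.toRationalMap →
        ∃ h : q.source ≤ U, X.homOfLE h ≫ f = q.iso.hom ≫ q.target.ι := by
  let U : X.Opens := ⟨(exceptionalLocus p)ᶜ, (isClosed_exceptionalLocus p).isOpen_compl⟩
  have hle : ∀ q : X.PartialIso Y, q.toRationalMap = p.toRationalMap → q.source ≤ U :=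
    fun q hq x hx h => h q hq hx
  have hdom : U ≤ p.toRationalMap.toPartialMap.domain := by
    intro x hx
    obtain ⟨q, hq, hxq⟩ : ∃ q : X.PartialIso Y, q.toRationalMap = p.toRationalMap ∧
        x ∈ q.source := by
      by_contra! h
      exact hx h
    rw [← hq]
    exact q.toPartialMap.le_domain_toRationalMap hxq
  refine ⟨U, X.homOfLE hdom ≫ p.toRationalMap.toPartialMap.hom, fun x => Iff.rfl,
    fun q hq => ⟨hle q hq, ?_⟩⟩
  rw [Scheme.homOfLE_homOfLE_assoc]
  have key : ∀ (r : X ⤏ Y) (h : q.toRationalMap = r) (h' : q.source ≤ r.toPartialMap.domain),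
      X.homOfLE h' ≫ r.toPartialMap.hom = q.iso.hom ≫ q.target.ι := by
    rintro _ rfl h'
    exact q.toPartialMap.toPartialMap_toRationalMap_restrict
  exact key _ hq _

/-- The representatives of a rational map glue to a morphism on the union of their sources. It is
an open immersion, being injective because the inverses of the representatives glue as well. -/
lemma exists_isMaximal [IsReduced X] [X.IsSeparated] [IsReduced Y] [Y.IsSeparated]
    (p : X.PartialIso Y) :
    ∃ q : X.PartialIso Y, q.toRationalMap = p.toRationalMap ∧ IsMaximal q := by
  obtain ⟨U, f, hU, hf⟩ := exists_hom_of_toRationalMap_eq p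
  have hmem : ∀ x ∈ U, ∃ q : X.PartialIso Y, q.toRationalMap = p.toRationalMap ∧
      x ∈ q.source := by
    intro x hx
    by_contra! h
    exact (hU x).mp hx h
  have hval : ∀ (q : X.PartialIso Y), q.toRationalMap = p.toRationalMap →
      ∀ x : U.toScheme, U.ι x ∈ q.source → MapsPt q (U.ι x) (f x) := by
    intro q hq x hx
    obtain ⟨h, e⟩ := hf q hq
    obtain ⟨z, hz⟩ := exists_ι_eq hx
    have hzx : X.homOfLE h z = x := by
      apply U.ι.isOpenEmbedding.injective
      rw [← hz, ← Scheme.Hom.comp_apply, X.homOfLE_ι]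
    refine ⟨z, hz, ?_⟩
    rw [← e, Scheme.Hom.comp_apply, hzx]
  have hopen : ∀ (q : X.PartialIso Y) (h : q.source ≤ U),
      X.homOfLE h ≫ f = q.iso.hom ≫ q.target.ι → IsOpenImmersion (X.homOfLE h ≫ f) := by
    intro q h e
    rw [e]
    infer_instance
  have hinj : Function.Injective f := by
    intro x x' hxx
    obtain ⟨q, hq, hx⟩ := hmem x.1 x.2
    obtain ⟨q', hq', hx'⟩ := hmem x'.1 x'.2
    have h1 := (hval q hq x hx).symm
    have h2 := (hval q' hq' x' hx').symm
    rw [hxx] at h1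
    exact U.ι.isOpenEmbedding.injective
      (h1.unique_of_toRationalMap_eq (toRationalMap_symm_congr (hq.trans hq'.symm)) h2)
  have : IsOpenImmersion f := by
    refine IsOpenImmersion.of_forall_source_exists f hinj fun x => ?_
    obtain ⟨q, hq, hx⟩ := hmem x.1 x.2
    obtain ⟨h, e⟩ := hf q hq
    obtain ⟨z, hz⟩ := exists_ι_eq hx
    refine ⟨q.source, X.homOfLE h, inferInstance, ⟨z, ?_⟩, hopen q h e⟩
    apply U.ι.isOpenEmbedding.injective
    rw [← Scheme.Hom.comp_apply, X.homOfLE_ι, hz]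
    rfl
  obtain ⟨h, e⟩ := hf p rfl
  let q : X.PartialIso Y :=
    { source := U
      dense_source := p.dense_source.mono h
      target := f.opensRange
      dense_target := by
        refine p.dense_target.mono ?_
        intro y hy
        obtain ⟨z, rfl⟩ := exists_ι_eq hy
        refine ⟨X.homOfLE h (p.iso.inv z), ?_⟩
        rw [← Scheme.Hom.comp_apply, e, ← Scheme.Hom.comp_apply, Iso.inv_hom_id_assoc]
      iso := f.isoOpensRange }
  have hq : q.toRationalMap = p.toRationalMap := by
    refine toRationalMap_eq_iff.mpr ⟨p.source, p.source.ι, _, inferInstance,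
      Opens.isDominant_ι p.dense_source, ⟨X.homOfLE h, ?_, ?_⟩, maps_source p⟩
    · exact X.homOfLE_ι h
    · rw [← e]
      exact congrArg (X.homOfLE h ≫ ·) f.isoOpensRange_hom_ι
  exact ⟨q, hq, fun r hr => (hf r (hr.trans hq)).1⟩

lemma IsMaximal.symm [IsReduced X] [X.IsSeparated] [IsReduced Y] [Y.IsSeparated]
    {p : X.PartialIso Y} (hp : IsMaximal p) : IsMaximal p.symm := by
  intro q hq
  have hq' : q.symm.toRationalMap = p.toRationalMap := toRationalMap_symm_congr hq
  intro y hy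
  obtain ⟨x, hx⟩ := exists_mapsPt hy
  obtain ⟨y', hy'⟩ := exists_mapsPt (hp _ hq' hx.symm.mem_source)
  rw [hx.symm.unique_of_toRationalMap_eq hq' hy']
  exact hy'.symm.mem_source

end Maximal

/-! ### Equivariant birational maps: composition, inverses, strict equivariance -/

section Composition

variable {X Y Z W T S : Scheme.{u}}

lemma trans_assoc_toRationalMap (p : X.PartialIso Y) (q : Y.PartialIso Z) (r : Z.PartialIso W) :
    ((p.trans q).trans r).toRationalMap = (p.trans (q.trans r)).toRationalMap := by
  have h := maps_source ((p.trans q).trans r)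
  refine toRationalMap_eq_iff.mpr ⟨_, _, _, inferInstance,
    Opens.isDominant_ι ((p.trans q).trans r).dense_source, h, ?_⟩
  obtain ⟨b, hb, hc⟩ := maps_trans_iff.mp h
  obtain ⟨a, ha, hd⟩ := maps_trans_iff.mp hb
  exact maps_trans_iff.mpr ⟨a, ha, maps_trans_iff.mpr ⟨b, hd, hc⟩⟩

lemma ofIso_symm_toRationalMap (e : X ≅ Y) :
    (Scheme.PartialIso.ofIso e).symm.toRationalMap =
      (Scheme.PartialIso.ofIso e.symm).toRationalMap := by
  refine toRationalMap_eq_iff.mpr ⟨_, 𝟙 Y, e.inv, inferInstance, inferInstance, ?_, ?_⟩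
  · have := (maps_ofIso e e.inv).symm
    rwa [Iso.inv_hom_id] at this
  · have := maps_ofIso e.symm (𝟙 Y)
    rwa [Category.id_comp] at this

lemma Maps.comp_eq_of_isOver {sX : X ⟶ S} {sY : Y ⟶ S} {p : X.PartialIso Y} (hp : p.IsOver sX sY)
    {a : T ⟶ X} {b : T ⟶ Y} (h : Maps p a b) : b ≫ sY = a ≫ sX := by
  obtain ⟨c, rfl, rfl⟩ := h
  simp only [Category.assoc]
  rw [hp]

lemma isOver_congr [IsReduced X] [S.IsSeparated] {sX : X ⟶ S} {sY : Y ⟶ S} {p q : X.PartialIso Y}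
    (hp : p.IsOver sX sY) (h : p.toRationalMap = q.toRationalMap) : q.IsOver sX sY := by
  obtain ⟨T, a, b, ha, hd, h1, h2⟩ := toRationalMap_eq_iff.mp h
  have e := h1.comp_eq_of_isOver hp
  have := isDominant_pullback_fst a q.source.ι
  refine ext_of_isDominant (Limits.pullback.fst q.source.ι a) ?_
  have h3 := h2.comp (Limits.pullback.snd q.source.ι a)
  have h4 := (maps_source q).comp (Limits.pullback.fst q.source.ι a)
  rw [Limits.pullback.condition] at h4
  have h5 := h4.unique h3
  rw [reassoc_of% h5, e, Limits.pullback.condition_assoc]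

end Composition

namespace GVariety

variable {k : Type u} [Field k] {G : Type v} [Group G] {d : ℕ} {V W W' : GVariety k G d}

lemma isSeparated_carrier (V : GVariety k G d) : V.carrier.IsSeparated := by
  have := V.isSeparated
  have : IsSeparated (Limits.terminal.from V.carrier) := by
    rw [← Limits.terminal.comp_from V.str]
    infer_instance
  exact ⟨this⟩

namespace IsEquivariantBirational

lemma congr {p q : V.carrier.PartialIso W.carrier} (hp : IsEquivariantBirational p)
    (h : p.toRationalMap = q.toRationalMap) : IsEquivariantBirational q := by
  have := V.isReduced
  refine ⟨isOver_congr hp.isOver h, fun g => ?_⟩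
  rw [← toRationalMap_trans_congr rfl h, ← toRationalMap_trans_congr h rfl]
  exact hp.equivariant g

lemma trans {p : V.carrier.PartialIso W.carrier} {q : W.carrier.PartialIso W'.carrier}
    (hp : IsEquivariantBirational p) (hq : IsEquivariantBirational q) :
    IsEquivariantBirational (p.trans q) := by
  refine ⟨hp.isOver.trans hq.isOver, fun g => ?_⟩
  rw [← trans_assoc_toRationalMap, toRationalMap_trans_congr (hp.equivariant g) rfl,
    trans_assoc_toRationalMap, toRationalMap_trans_congr rfl (hq.equivariant g),
    trans_assoc_toRationalMap]

lemma symm {p : V.carrier.PartialIso W.carrier} (hp : IsEquivariantBirational p) :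
    IsEquivariantBirational p.symm := by
  refine ⟨hp.isOver.symm, fun g => ?_⟩
  have h (U : GVariety k G d) : (Scheme.PartialIso.ofIso (U.actIso g⁻¹)).symm.toRationalMap =
      (Scheme.PartialIso.ofIso (U.actIso g)).toRationalMap := by
    rw [ofIso_symm_toRationalMap]
    congr 3
    ext1
    change U.act (g⁻¹)⁻¹ = U.act g
    rw [inv_inv]
  have := toRationalMap_symm_congr (hp.equivariant g⁻¹)
  rw [symm_trans_toRationalMap, symm_trans_toRationalMap, toRationalMap_trans_congr rfl (h V),
    toRationalMap_trans_congr (h W) rfl] at this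
  exact this.symm

/-- A maximal representative of an equivariant birational map is strictly equivariant: its source
is stable under the action, and it commutes with the action. -/
lemma maps_act {p : V.carrier.PartialIso W.carrier} (hp : IsEquivariantBirational p)
    (hm : IsMaximal p) {T : Scheme.{u}} {a : T ⟶ V.carrier} {b : T ⟶ W.carrier} (h : Maps p a b)
    (g : G) : Maps p (a ≫ V.act g) (b ≫ W.act g) := by
  have := V.isReduced
  have := W.isSeparated_carrier
  -- The conjugate of `p` by `g` represents the same rational map, so `p` is defined on its source.
  let q := (Scheme.PartialIso.ofIso (V.actIso g⁻¹)).trans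
    (p.trans (Scheme.PartialIso.ofIso (W.actIso g)))
  have hq : q.toRationalMap = p.toRationalMap := by
    rw [← toRationalMap_trans_congr rfl (hp.equivariant g), ← trans_assoc_toRationalMap]
    have h1 := maps_source p
    refine toRationalMap_eq_iff.mpr ⟨_, _, _, inferInstance, Opens.isDominant_ι p.dense_source,
      maps_trans_iff.mpr ⟨_, maps_trans_iff.mpr ⟨_, maps_ofIso _ _, maps_ofIso _ _⟩, ?_⟩, h1⟩
    simpa [← V.act_mul, V.act_one] using h1
  have h2 : Maps q (a ≫ V.act g) (b ≫ W.act g) := by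
    refine maps_trans_iff.mpr ⟨_, maps_ofIso _ _, maps_trans_iff.mpr ⟨b, ?_, maps_ofIso _ _⟩⟩
    simpa [← V.act_mul, V.act_one] using h
  obtain ⟨b', hb'⟩ := exists_maps p (a ≫ V.act g) (h2.range_subset.trans (hm q hq))
  rwa [h2.unique_of_toRationalMap_eq hq hb']

lemma mapsPt_act {p : V.carrier.PartialIso W.carrier} (hp : IsEquivariantBirational p)
    (hm : IsMaximal p) {x : V.carrier} {y : W.carrier} (h : MapsPt p x y) (g : G) :
    MapsPt p (V.act g x) (W.act g y) := by
  obtain ⟨z, rfl, rfl⟩ := h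
  exact (maps_act hp hm (maps_source p) g).mapsPt z

lemma act_mem_source_iff {p : V.carrier.PartialIso W.carrier} (hp : IsEquivariantBirational p)
    (hm : IsMaximal p) {x : V.carrier} (g : G) : V.act g x ∈ p.source ↔ x ∈ p.source := by
  have key : ∀ g x, x ∈ p.source → V.act g x ∈ p.source := by
    intro g x hx
    obtain ⟨y, hy⟩ := exists_mapsPt hx
    exact (mapsPt_act hp hm hy g).mem_source
  refine ⟨fun h => ?_, key g x⟩
  have := key g⁻¹ _ h
  rwa [← act_mul_apply, inv_mul_cancel, act_one_apply] at this

end IsEquivariantBirational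

end GVariety

/-! ### Strict transforms -/

section StrictTransform

variable {X Y : Scheme.{u}}

/-- The set of images under `p` of those points of `E` at which `p` is defined. -/
def partialImage (p : X.PartialIso Y) (E : Set X) : Set Y :=
  (p.iso.hom ≫ p.target.ι) '' (p.source.ι ⁻¹' E)

/-- The strict transform of a closed subset under a partial isomorphism. -/
def strictTransform (p : X.PartialIso Y) (E : Set X) : Set Y :=
  closure (partialImage p E)

lemma mem_partialImage {p : X.PartialIso Y} {E : Set X} {y : Y} :
    y ∈ partialImage p E ↔ ∃ x ∈ E, MapsPt p x y :=
  ⟨fun ⟨z, hz, h⟩ => ⟨_, hz, z, rfl, h⟩, fun ⟨_, hx, z, h, h'⟩ => ⟨z, by rwa [← h] at hx, h'⟩⟩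

lemma strictTransform_inter_target {p : X.PartialIso Y} {E : Set X} (hE : IsClosed E) :
    strictTransform p E ∩ p.target = partialImage p E := by
  apply subset_antisymm
  · rintro y ⟨hy, hyt⟩
    obtain ⟨x, hx⟩ := exists_mapsPt (p := p.symm) hyt
    obtain ⟨z, rfl, rfl⟩ := hx.symm
    have h := (p.iso.hom ≫ p.target.ι).isOpenEmbedding.isInducing.closure_eq_preimage_closure_image
      (p.source.ι ⁻¹' E)
    rw [(hE.preimage p.source.ι.continuous).closure_eq] at h
    exact ⟨z, h ▸ hy, rfl⟩
  · intro y hy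
    refine ⟨subset_closure hy, ?_⟩
    obtain ⟨x, -, hx⟩ := mem_partialImage.mp hy
    exact hx.symm.mem_source

lemma partialImage_symm_partialImage (p : X.PartialIso Y) (E : Set X) :
    partialImage p.symm (partialImage p E) = E ∩ p.source := by
  ext x
  simp only [mem_partialImage]
  constructor
  · rintro ⟨y, ⟨x', hx', h⟩, h'⟩
    rw [← h.symm.unique h']
    exact ⟨hx', h.mem_source⟩
  · rintro ⟨hx, hxs⟩
    obtain ⟨y, hy⟩ := exists_mapsPt hxs
    exact ⟨y, ⟨x, hx, hy⟩, hy.symm⟩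

lemma partialImage_inter_source (p : X.PartialIso Y) (E : Set X) :
    partialImage p (E ∩ p.source) = partialImage p E := by
  ext y
  simp only [mem_partialImage]
  exact ⟨fun ⟨x, hx, h⟩ => ⟨x, hx.1, h⟩, fun ⟨x, hx, h⟩ => ⟨x, ⟨hx, h.mem_source⟩, h⟩⟩

/-- Strict transforms under mutually inverse maps are mutually inverse on closed sets that
are the closure of their part in the source. -/
lemma strictTransform_symm_strictTransform {p : X.PartialIso Y} {E : Set X} (hE : IsClosed E)
    (h : E ⊆ closure (E ∩ p.source)) : strictTransform p.symm (strictTransform p E) = E := by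
  rw [strictTransform, ← partialImage_inter_source]
  have := strictTransform_inter_target (p := p) hE
  change closure (partialImage p.symm (strictTransform p E ∩ p.target)) = E
  rw [this, partialImage_symm_partialImage]
  exact (closure_minimal Set.inter_subset_left hE).antisymm h

lemma partialImage_nonempty {p : X.PartialIso Y} {E : Set X} (h : (E ∩ p.source).Nonempty) :
    (partialImage p E).Nonempty := by
  obtain ⟨x, hx, hxs⟩ := h
  obtain ⟨y, hy⟩ := exists_mapsPt hxs
  exact ⟨y, mem_partialImage.mpr ⟨x, hx, hy⟩⟩

lemma topologicalKrullDim_partialImage (p : X.PartialIso Y) (E : Set X) :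
    topologicalKrullDim (partialImage p E) = topologicalKrullDim (E ∩ p.source : Set X) := by
  have h1 := IsHomeomorph.topologicalKrullDim_eq _
    ((p.iso.hom ≫ p.target.ι).isOpenEmbedding.isEmbedding.homeomorphImage
      (p.source.ι ⁻¹' E)).isHomeomorph
  have h2 := IsHomeomorph.topologicalKrullDim_eq _
    (p.source.ι.isOpenEmbedding.isEmbedding.homeomorphImage (p.source.ι ⁻¹' E)).isHomeomorph
  rw [Set.image_preimage_eq_inter_range, Scheme.Opens.range_ι] at h2
  exact h1.symm.trans h2

lemma isIrreducible_strictTransform {p : X.PartialIso Y} {D : Set X} (hD : IsIrreducible D)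
    (h : (D ∩ p.source).Nonempty) : IsIrreducible (strictTransform p D) := by
  refine IsIrreducible.closure ⟨partialImage_nonempty h, ?_⟩
  exact (hD.2.preimage p.source.ι.isOpenEmbedding).image _
    (p.iso.hom ≫ p.target.ι).continuous.continuousOn

lemma topologicalKrullDim_strictTransform {k : Type u} [Field k] (sX : X ⟶ Spec (.of k))
    (sY : Y ⟶ Spec (.of k)) [LocallyOfFiniteType sX] [LocallyOfFiniteType sY]
    {p : X.PartialIso Y} {D : Set X} (hDc : IsClosed D) (hD : IsIrreducible D)
    (h : (D ∩ p.source).Nonempty) :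
    topologicalKrullDim (strictTransform p D) = topologicalKrullDim D := by
  have e := strictTransform_inter_target (p := p) hDc
  rw [← topologicalKrullDim_inter_open sX hDc hD p.source h,
    ← topologicalKrullDim_partialImage, ← e]
  refine (topologicalKrullDim_inter_open sY isClosed_closure (isIrreducible_strictTransform hD h)
    p.target ?_).symm
  exact e.symm ▸ partialImage_nonempty h

end StrictTransform

namespace GVariety

variable {k : Type u} [Field k] {G : Type v} [Group G] {d m : ℕ} {V W W' : GVariety k G d}

lemma mem_orbit {D : Set V.carrier} {x : V.carrier} :
    x ∈ V.orbit D ↔ ∃ g, ∃ y ∈ D, V.act g y = x := by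
  simp [orbit]

lemma subset_orbit (D : Set V.carrier) : D ⊆ V.orbit D :=
  fun x hx => mem_orbit.mpr ⟨1, x, hx, V.act_one_apply x⟩

/-- An orbit of irreducible sets meeting a stable open set `U` is the closure of its part in `U`. -/
lemma orbit_subset_closure_inter {D : Set V.carrier} (hD : IsIrreducible D) {U : Opens V.carrier}
    (hU : ∀ g, ∀ x ∈ U, V.act g x ∈ U) (h : (V.orbit D ∩ U).Nonempty) :
    V.orbit D ⊆ closure (V.orbit D ∩ U) := by
  have hDU : (D ∩ U).Nonempty := by
    obtain ⟨x, hx, hxU⟩ := h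
    obtain ⟨g, y, hy, rfl⟩ := mem_orbit.mp hx
    have := hU g⁻¹ _ hxU
    rw [← act_mul_apply, inv_mul_cancel, act_one_apply] at this
    exact ⟨y, hy, this⟩
  intro x hx
  obtain ⟨g, y, hy, rfl⟩ := mem_orbit.mp hx
  have h1 := subset_closure_inter_of_isPreirreducible_of_isOpen hD.2 U.isOpen hDU hy
  have h2 := (image_closure_subset_closure_image (V.act g).continuous) ⟨y, h1, rfl⟩
  refine closure_mono ?_ h2
  rintro _ ⟨z, hz, rfl⟩
  exact ⟨mem_orbit.mpr ⟨g, z, hz.1, rfl⟩, hU g z hz.2⟩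

section

variable {p : V.carrier.PartialIso W.carrier}

lemma partialImage_orbit (hp : IsEquivariantBirational p) (hm : IsMaximal p)
    (D : Set V.carrier) : partialImage p (V.orbit D) = W.orbit (partialImage p D) := by
  ext y
  simp only [mem_partialImage, mem_orbit]
  constructor
  · rintro ⟨_, ⟨g, x, hx, rfl⟩, h⟩
    have := hp.mapsPt_act hm h g⁻¹
    rw [← act_mul_apply, inv_mul_cancel, act_one_apply] at this
    exact ⟨g, _, ⟨x, hx, this⟩, by rw [← act_mul_apply, mul_inv_cancel, act_one_apply]⟩
  · rintro ⟨g, y, ⟨x, hx, h⟩, rfl⟩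
    exact ⟨_, ⟨g, x, hx, rfl⟩, hp.mapsPt_act hm h g⟩

lemma strictTransform_orbit [Finite G] (hp : IsEquivariantBirational p) (hm : IsMaximal p)
    (D : Set V.carrier) : strictTransform p (V.orbit D) = W.orbit (strictTransform p D) := by
  rw [strictTransform, partialImage_orbit hp hm, orbit, closure_iUnion_of_finite, orbit]
  exact Set.iUnion_congr fun g => ((W.isHomeomorph_act g).homeomorph.image_closure _).symm

lemma IsOrbitOfDim.subset_closure_inter (hp : IsEquivariantBirational p) (hm : IsMaximal p)
    {E : Set V.carrier} (hE : V.IsOrbitOfDim m E) (h : (E ∩ p.source).Nonempty) :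
    E ⊆ closure (E ∩ p.source) := by
  obtain ⟨D, hD, hDi, hDm, rfl⟩ := hE
  exact orbit_subset_closure_inter hDi (fun g x hx => (hp.act_mem_source_iff hm g).mpr hx) h

lemma IsOrbitOfDim.strictTransform [Finite G] (hp : IsEquivariantBirational p) (hm : IsMaximal p)
    {E : Set V.carrier} (hE : V.IsOrbitOfDim m E) (h : (E ∩ p.source).Nonempty) :
    W.IsOrbitOfDim m (strictTransform p E) := by
  obtain ⟨D, hD, hDi, hDm, rfl⟩ := hE
  have hDU : (D ∩ p.source).Nonempty := by
    obtain ⟨x, hx, hxU⟩ := h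
    obtain ⟨g, y, hy, rfl⟩ := mem_orbit.mp hx
    exact ⟨y, hy, (hp.act_mem_source_iff hm g).mp hxU⟩
  have := V.locallyOfFiniteType
  have := W.locallyOfFiniteType
  exact ⟨_, isClosed_closure, isIrreducible_strictTransform hDi hDU,
    (topologicalKrullDim_strictTransform V.str W.str hD hDi hDU).trans hDm,
    strictTransform_orbit hp hm D⟩

lemma IsOrbitOfDim.strictTransform_symm_strictTransform [Finite G]
    (hp : IsEquivariantBirational p) (hm : IsMaximal p)
    {E : Set V.carrier} (hE : V.IsOrbitOfDim m E) (h : (E ∩ p.source).Nonempty) :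
    EquivBir.strictTransform p.symm (EquivBir.strictTransform p E) = E :=
  EquivBir.strictTransform_symm_strictTransform hE.isClosed (hE.subset_closure_inter hp hm h)

lemma strictTransform_inter_target_nonempty {E : Set V.carrier}
    (h : (E ∩ p.source).Nonempty) : (EquivBir.strictTransform p E ∩ p.target).Nonempty := by
  obtain ⟨y, hy⟩ := partialImage_nonempty h
  obtain ⟨x, -, hx⟩ := mem_partialImage.mp hy
  exact ⟨y, subset_closure hy, hx.symm.mem_source⟩

end

end GVariety

/-! ### Trivial generic stabilizers under strict transforms -/

namespace GVariety

variable {k : Type u} [Field k] {G : Type v} [Group G] {d m : ℕ} {V W W' : GVariety k G d}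

lemma jacobsonSpace (V : GVariety k G d) : JacobsonSpace V.carrier :=
  have := V.locallyOfFiniteType
  LocallyOfFiniteType.jacobsonSpace V.str

/-- Over an algebraically closed field, the closed points fixed by `g` are the closed points of a
closed subset, namely of the equalizer of `g` and the identity. -/
lemma exists_isClosed_fixed [IsAlgClosed k] (V : GVariety k G d) (g : G) :
    ∃ F : Set V.carrier, IsClosed F ∧ ∀ x, IsClosed {x} → (x ∈ F ↔ V.act g x = x) := by
  have := V.isSeparated
  have := V.locallyOfFiniteType
  have := V.isSeparated_carrier
  refine ⟨Set.range (Limits.equalizer.ι (V.act g) (𝟙 V.carrier)),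
    (Limits.equalizer.ι (V.act g) (𝟙 V.carrier)).isClosedEmbedding.isClosed_range,
    fun x hx => ⟨?_, fun h => ?_⟩⟩
  · rintro ⟨y, rfl⟩
    rw [← Scheme.Hom.comp_apply, Limits.equalizer.condition]
    simp
  · let a := pointOfClosedPoint V.str x hx
    have ha : a ≫ V.str = 𝟙 _ := pointOfClosedPoint_comp _ _ _
    have hax : ∀ t, a t = x := pointOfClosedPoint_apply V.str x hx
    have : a ≫ V.act g = a ≫ 𝟙 _ := by
      rw [Category.comp_id]
      refine ext_of_apply_closedPoint_eq V.str (by rw [Category.assoc, V.act_str, ha]) ha ?_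
      exact (Scheme.Hom.comp_apply a (V.act g) _).trans
        ((congrArg (V.act g) (hax _)).trans (h.trans (hax _).symm))
    have t : Spec (.of k) := IsLocalRing.closedPoint k
    refine ⟨Limits.equalizer.lift a this t, ?_⟩
    rw [← Scheme.Hom.comp_apply, Limits.equalizer.lift_ι, hax]

/-- If the generic stabilizer of the orbit `E` is trivial then a point with trivial stabilizer
can be found in any stable open set meeting `E`. -/
lemma HasTrivialGenericStabilizer.exists_mem_open [IsAlgClosed k] [Finite G] {E : Set V.carrier}
    (hs : V.HasTrivialGenericStabilizer E) (hE : V.IsOrbitOfDim m E) {U : Opens V.carrier}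
    (hU : ∀ g, ∀ x ∈ U, V.act g x ∈ U) (h : (E ∩ U).Nonempty) :
    ∃ x ∈ E, x ∈ U ∧ IsClosed {x} ∧ ∀ g ≠ 1, V.act g x ≠ x := by
  have := V.jacobsonSpace
  obtain ⟨x, hxE, hx, hfree⟩ := hs
  have hE' := hE
  obtain ⟨D, hD, hDi, -, rfl⟩ := hE'
  choose F hF hFx using V.exists_isClosed_fixed
  let O : Set V.carrier := (⋃ g : {g : G // g ≠ 1}, F g)ᶜ
  have hO : IsOpen O := (isClosed_iUnion_of_finite fun g : {g : G // g ≠ 1} => hF g.1).isOpen_compl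
  have hxO : x ∈ O := by
    simp only [O, Set.mem_compl_iff, Set.mem_iUnion, not_exists]
    exact fun g hg => hfree g.1 g.2 ((hFx g.1 x hx).mp hg)
  have hd := orbit_subset_closure_inter hDi hU h hxE
  obtain ⟨y, hyO, hyE, hyU⟩ := mem_closure_iff.mp hd O hO hxO
  obtain ⟨z, ⟨⟨hzE, hzU⟩, hzO⟩, hz⟩ := nonempty_inter_closedPoints
    (Z := V.orbit D ∩ U ∩ O) ⟨y, ⟨hyE, hyU⟩, hyO⟩
    ((hE.isClosed.isLocallyClosed.inter U.isOpen.isLocallyClosed).inter hO.isLocallyClosed)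
  refine ⟨z, hzE, hzU, hz, fun g hg h => ?_⟩
  simp only [O, Set.mem_compl_iff, Set.mem_iUnion, not_exists] at hzO
  exact hzO ⟨g, hg⟩ ((hFx g z hz).mpr h)

lemma MapsPt.isClosed {p : V.carrier.PartialIso W.carrier} {x : V.carrier} {y : W.carrier}
    (h : MapsPt p x y) (hx : IsClosed {x}) : IsClosed {y} := by
  have := W.jacobsonSpace
  obtain ⟨z, rfl, rfl⟩ := h
  have hz : IsClosed {z} := by
    have := hx.preimage p.source.ι.continuous
    rwa [← Set.image_singleton,
      Set.preimage_image_eq _ p.source.ι.isOpenEmbedding.injective] at this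
  have := (p.iso.hom ≫ p.target.ι).isOpenEmbedding.preimage_closedPoints
  exact this.ge hz

lemma HasTrivialGenericStabilizer.strictTransform [IsAlgClosed k] [Finite G]
    {p : V.carrier.PartialIso W.carrier} (hp : IsEquivariantBirational p) (hm : IsMaximal p)
    {E : Set V.carrier} (hs : V.HasTrivialGenericStabilizer E) (hE : V.IsOrbitOfDim m E)
    (h : (E ∩ p.source).Nonempty) : W.HasTrivialGenericStabilizer (strictTransform p E) := by
  obtain ⟨x, hxE, hxU, hx, hfree⟩ := hs.exists_mem_open hE
    (fun g x hx => (hp.act_mem_source_iff hm g).mpr hx) h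
  obtain ⟨y, hy⟩ := exists_mapsPt hxU
  refine ⟨y, subset_closure (mem_partialImage.mpr ⟨x, hxE, hy⟩), MapsPt.isClosed hy hx,
    fun g hg e => hfree g hg ?_⟩
  have := hp.mapsPt_act hm hy g
  rw [e] at this
  exact this.injective hy

end GVariety

section ReducedSubscheme

variable {X Y T : Scheme.{u}}

/-- A morphism from a reduced scheme whose image lies in the closed set `Z` factors through the
reduced closed subscheme on `Z`. -/
lemma exists_lift_reducedSubscheme [IsReduced T] (Z : Closeds X) (a : T ⟶ X)
    (ha : Set.range a ⊆ Z) : ∃ b : T ⟶ reducedSubscheme Z, b ≫ reducedSubschemeι Z = a := by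
  refine ⟨IsClosedImmersion.lift (reducedSubschemeι Z) a ?_, IsClosedImmersion.lift_fac _ _ _⟩
  have h : Scheme.IdealSheafData.vanishingIdeal (⊤ : Closeds T) = ⊥ := by
    rw [Scheme.IdealSheafData.vanishingIdeal_top, Scheme.nilradical_eq_bot]
  rw [← Scheme.IdealSheafData.map_bot a, ← h, Scheme.IdealSheafData.map_vanishingIdeal,
    reducedSubschemeι, Scheme.IdealSheafData.ker_subschemeι]
  refine Scheme.IdealSheafData.vanishingIdeal_antimono (closure_minimal ?_ Z.isClosed)
  simpa using ha

end ReducedSubscheme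

/-! ### Birational classes of strict transforms -/

section ReducedSubscheme

variable {X Y T : Scheme.{u}}

lemma exists_maps_reducedSubscheme (p : X.PartialIso Y) (Z : Closeds X) (Z' : Closeds Y)
    (h : ∀ x y, MapsPt p x y → x ∈ Z → y ∈ Z') :
    ∃ f : (reducedSubschemeι Z ⁻¹ᵁ p.source).toScheme ⟶
        (reducedSubschemeι Z' ⁻¹ᵁ p.target).toScheme,
      Maps p ((reducedSubschemeι Z ⁻¹ᵁ p.source).ι ≫ reducedSubschemeι Z)
        (f ≫ (reducedSubschemeι Z' ⁻¹ᵁ p.target).ι ≫ reducedSubschemeι Z') := by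
  obtain ⟨b, hb⟩ := exists_maps p ((reducedSubschemeι Z ⁻¹ᵁ p.source).ι ≫ reducedSubschemeι Z) (by
    rintro _ ⟨x, rfl⟩
    rw [Scheme.Hom.comp_apply]
    exact x.2)
  obtain ⟨b, rfl⟩ := exists_lift_reducedSubscheme Z' b (by
    rintro _ ⟨x, rfl⟩
    refine h _ _ (hb.mapsPt x) ?_
    rw [Scheme.Hom.comp_apply]
    exact (range_reducedSubschemeι Z).le (Set.mem_range_self _))
  have hr : Set.range b ⊆ Set.range (reducedSubschemeι Z' ⁻¹ᵁ p.target).ι := by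
    rw [Scheme.Opens.range_ι]
    rintro _ ⟨x, rfl⟩
    have := (hb.mapsPt x).symm.mem_source
    rwa [Scheme.Hom.comp_apply] at this
  refine ⟨IsOpenImmersion.lift _ b hr, ?_⟩
  rwa [IsOpenImmersion.lift_fac_assoc]

lemma dense_preimage_reducedSubschemeι {Z : Closeds X} {U : X.Opens}
    (h : (Z : Set X) ⊆ closure (Z ∩ U)) :
    Dense ((reducedSubschemeι Z ⁻¹ᵁ U : Opens _) : Set (reducedSubscheme Z)) := by
  intro x
  have := (reducedSubschemeι Z).isClosedEmbedding.isInducing.closure_eq_preimage_closure_image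
    (reducedSubschemeι Z ⁻¹' U)
  rw [Set.image_preimage_eq_inter_range, range_reducedSubschemeι, Set.inter_comm] at this
  exact this.ge (h ((range_reducedSubschemeι Z).le (Set.mem_range_self x)))

/-- A partial isomorphism restricts to a partial isomorphism between a closed subset which is the
closure of its part in the source, and its strict transform. -/
lemma exists_partialIso_reducedSubscheme (p : X.PartialIso Y) (Z : Closeds X) (Z' : Closeds Y)
    (hZ : (Z : Set X) ⊆ closure (Z ∩ p.source)) (hZ' : strictTransform p Z = Z') :
    ∃ q : (reducedSubscheme Z).PartialIso (reducedSubscheme Z'),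
      q.source = reducedSubschemeι Z ⁻¹ᵁ p.source ∧
      ∀ {T : Scheme.{u}} {a : T ⟶ reducedSubscheme Z} {b : T ⟶ reducedSubscheme Z'}, Maps q a b →
        Maps p (a ≫ reducedSubschemeι Z) (b ≫ reducedSubschemeι Z') := by
  have hi := strictTransform_inter_target (p := p) Z.isClosed
  rw [hZ'] at hi
  obtain ⟨f, hf⟩ := exists_maps_reducedSubscheme p Z Z' fun x y h hx =>
    (hi.ge (mem_partialImage.mpr ⟨x, hx, h⟩)).1
  obtain ⟨g, hg⟩ : ∃ g : (reducedSubschemeι Z' ⁻¹ᵁ p.target).toScheme ⟶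
      (reducedSubschemeι Z ⁻¹ᵁ p.source).toScheme,
      Maps p.symm ((reducedSubschemeι Z' ⁻¹ᵁ p.target).ι ≫ reducedSubschemeι Z')
        (g ≫ (reducedSubschemeι Z ⁻¹ᵁ p.source).ι ≫ reducedSubschemeι Z) :=
    exists_maps_reducedSubscheme p.symm Z' Z fun y x h hy => by
      obtain ⟨x', hx', h'⟩ := mem_partialImage.mp (hi.le ⟨hy, h.mem_source⟩)
      rwa [h.unique h'.symm]
  have hfg : f ≫ g = 𝟙 _ := by
    rw [← cancel_mono (Scheme.Opens.ι _), ← cancel_mono (reducedSubschemeι Z)]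
    have := (hg.comp f).unique hf.symm
    simpa only [Category.assoc, Category.id_comp] using this
  have hgf : g ≫ f = 𝟙 _ := by
    rw [← cancel_mono (Scheme.Opens.ι _), ← cancel_mono (reducedSubschemeι Z')]
    have := (hf.comp g).unique hg.symm
    simpa only [Category.assoc, Category.id_comp] using this
  refine ⟨{ source := reducedSubschemeι Z ⁻¹ᵁ p.source
            dense_source := dense_preimage_reducedSubschemeι hZ
            target := reducedSubschemeι Z' ⁻¹ᵁ p.target
            dense_target := dense_preimage_reducedSubschemeι (by rw [hi, ← hZ']; exact le_rfl)
            iso := ⟨f, g, hfg, hgf⟩ }, rfl, ?_⟩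
  rintro T _ _ ⟨c, rfl, rfl⟩
  have := hf.comp c
  simpa only [Category.assoc] using this

end ReducedSubscheme

namespace GVariety

variable {k : Type u} [Field k] {G : Type v} [Group G] {d m : ℕ} {V W W' : GVariety k G d}

/-- An orbit meeting the source of a maximal equivariant birational map is equivariantly birational
to its strict transform. -/
lemma birational_strictTransform [Finite G]
    {p : V.carrier.PartialIso W.carrier} (hp : IsEquivariantBirational p) (hm : IsMaximal p)
    {E : Set V.carrier} {F : Set W.carrier} (hE : V.IsOrbitOfDim m E) (hF : W.IsOrbitOfDim m F)
    (hs : V.HasTrivialGenericStabilizer E) (hs' : W.HasTrivialGenericStabilizer F)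
    (h : (E ∩ p.source).Nonempty) (hEF : strictTransform p E = F) :
    Birational (orbitVariety hE hs) (orbitVariety hF hs') := by
  obtain ⟨q, hqs, hq⟩ := exists_partialIso_reducedSubscheme p ⟨E, hE.isClosed⟩ ⟨F, hF.isClosed⟩
    (hE.subset_closure_inter hp hm h) hEF
  have hopen : IsOpenImmersion q.source.ι := inferInstance
  refine ⟨q, ?_, fun g => ?_⟩
  · have := (hq (maps_source q)).comp_eq_of_isOver hp.isOver
    simpa [orbitVariety, Scheme.PartialIso.IsOver] using this
  · let actE := V.restrictAct ⟨E, hE.isClosed⟩ hE.image_act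
    let actF := W.restrictAct ⟨F, hF.isClosed⟩ hF.image_act
    obtain ⟨b, hb⟩ := exists_maps q (q.source.ι ≫ actE g) (by
      rintro _ ⟨x, rfl⟩
      refine hqs.ge ?_
      rw [Scheme.Hom.comp_apply]
      change reducedSubschemeι _ (actE g _) ∈ p.source
      rw [V.restrictAct_apply]
      exact (hp.act_mem_source_iff hm g).mpr (hqs.le x.2))
    have h1 := hq hb
    have h2 := hp.maps_act hm (hq (maps_source q)) g
    have e1 : (q.source.ι ≫ actE g) ≫ reducedSubschemeι _ =
        (q.source.ι ≫ reducedSubschemeι _) ≫ V.act g := by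
      simp [actE, restrictAct_ι]
    rw [e1] at h1
    have h3 := h1.unique h2
    have e2 : b = (q.iso.hom ≫ q.target.ι) ≫ actF g := by
      rw [← cancel_mono (reducedSubschemeι _), h3]
      simp [actF, restrictAct_ι]
    subst e2
    exact toRationalMap_eq_iff.mpr ⟨_, q.source.ι, _, hopen,
      Opens.isDominant_ι q.dense_source,
      maps_trans_iff.mpr ⟨_, maps_ofIso ((orbitVariety hE hs).actIso g) _, hb⟩,
      maps_trans_iff.mpr ⟨_, maps_source q, maps_ofIso ((orbitVariety hF hs').actIso g) _⟩⟩

open Classical in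
/-- The equivariant birational class of the orbit `E` of an `m`-dimensional closed subset, or zero
if the generic stabilizer of `E` is not trivial. -/
def orbitClass [Finite G] (V : GVariety k G d) (m : ℕ) (E : Set V.carrier) : ZBir k G m :=
  if h : V.IsOrbitOfDim m E ∧ V.HasTrivialGenericStabilizer E then
    FreeAbelianGroup.of (Quot.mk _ (orbitVariety h.1 h.2))
  else 0

lemma orbitClass_strictTransform [IsAlgClosed k] [Finite G]
    {p : V.carrier.PartialIso W.carrier} (hp : IsEquivariantBirational p) (hm : IsMaximal p)
    {E : Set V.carrier} (hE : V.IsOrbitOfDim m E) (h : (E ∩ p.source).Nonempty) :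
    W.orbitClass m (strictTransform p E) = V.orbitClass m E := by
  have := V.isReduced
  have := W.isReduced
  have := V.isSeparated_carrier
  have := W.isSeparated_carrier
  have hF := hE.strictTransform hp hm h
  by_cases hs : V.HasTrivialGenericStabilizer E
  · have hs' := hs.strictTransform hp hm hE h
    rw [orbitClass, orbitClass, dif_pos ⟨hF, hs'⟩, dif_pos ⟨hE, hs⟩]
    congr 1
    exact (Quot.sound (birational_strictTransform hp hm hE hF hs hs' h rfl)).symm
  · have hs' : ¬ W.HasTrivialGenericStabilizer (strictTransform p E) := by
      intro hs'
      have := hs'.strictTransform hp.symm hm.symm hF (strictTransform_inter_target_nonempty h)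
      rw [hE.strictTransform_symm_strictTransform hp hm h] at this
      exact hs this
    rw [orbitClass, orbitClass, dif_neg (fun h => hs' h.2), dif_neg (fun h => hs h.2)]

end GVariety

/-! ### Exceptional orbits and additivity of the invariant -/

section Rotation

variable {X Y Z : Scheme.{u}} {φ : X.PartialIso Y} {ψ : Y.PartialIso Z} {χ : X.PartialIso Z}

lemma toRationalMap_trans_symm_eq (h : χ.toRationalMap = (φ.trans ψ).toRationalMap) :
    (χ.trans ψ.symm).toRationalMap = φ.toRationalMap :=
  (toRationalMap_trans_congr h rfl).trans (symm_trans_cancel_toRationalMap φ ψ)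

lemma toRationalMap_symm_trans_eq (h : χ.toRationalMap = (φ.trans ψ).toRationalMap) :
    (φ.symm.trans χ).toRationalMap = ψ.toRationalMap := by
  have h' := (toRationalMap_symm_congr h).trans (symm_trans_toRationalMap φ ψ)
  have h'' := toRationalMap_symm_congr (toRationalMap_trans_symm_eq h')
  exact (symm_trans_toRationalMap χ.symm φ).symm.trans h''

end Rotation

/-- In a Noetherian space of dimension at most `m + 1`, an irreducible closed set of dimension `m`
is maximal among the irreducible sets which do not meet a given dense open set. -/
lemma subset_of_disjoint_dense_open {X : Type*} [TopologicalSpace X] [NoetherianSpace X] {m : ℕ}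
    (hX : topologicalKrullDim X ≤ (m + 1 : ℕ)) {U : Set X} (hU : IsOpen U) (hd : Dense U)
    {D T : Set X} (hD : IsClosed D) (hDm : topologicalKrullDim D = m) (hT : IsIrreducible T)
    (hTU : T ⊆ Uᶜ) (hDT : D ⊆ T) : T ⊆ D := by
  -- Otherwise `D ⊂ closure T ⊂ Z` for a component `Z` of `X`, which prolongs a chain of length `m`
  -- in `D` by two steps.
  by_contra hTD
  obtain ⟨Z, hZ, hTZ⟩ := exists_mem_irreducibleComponents_subset_of_isIrreducible _ hT.closure
  have hZT : ¬ Z ⊆ closure T := fun h => by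
    obtain ⟨O, hO, hOne, hOZ⟩ :=
      NoetherianSpace.exists_isOpen_nonempty_subset_irreducibleComponent Z hZ
    obtain ⟨x, hxO, hxU⟩ := hd.inter_open_nonempty O hO hOne
    exact closure_minimal hTU hU.isClosed_compl (h (hOZ hxO)) hxU
  obtain ⟨l, hl⟩ := Order.le_krullDim_iff.mp hDm.ge
  let f := IrreducibleCloseds.map_strictMono_of_isInducing
    (Topology.IsInducing.subtypeVal (t := D))
  let l₁ := l.map _ f
  let T' : IrreducibleCloseds X := ⟨closure T, hT.closure, isClosed_closure⟩
  let Z' : IrreducibleCloseds X := ⟨Z, hZ.1, isClosed_of_mem_irreducibleComponents Z hZ⟩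
  have h₁ : l₁.last < T' := by
    have h : (l₁.last : Set X) ⊆ D := by
      change closure (Subtype.val '' _) ⊆ D
      exact closure_minimal (by rintro _ ⟨x, -, rfl⟩; exact x.2) hD
    exact lt_of_le_not_ge (h.trans (hDT.trans subset_closure))
      fun h' => hTD (subset_closure.trans (Set.Subset.trans h' h))
  have h₂ : T' < Z' := lt_of_le_not_ge hTZ hZT
  have := (Order.le_krullDim_iff (n := m + 2)).mpr
    ⟨(l₁.snoc T' h₁).snoc Z' (by rwa [RelSeries.last_snoc]), by simp [l₁, hl]⟩
  have h3 := this.trans hX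
  norm_cast at h3
  omega

namespace GVariety

variable {k : Type u} [Field k] {G : Type v} [Group G] {m : ℕ} {V W W' : GVariety k G (m + 1)}

/-- For a maximal equivariant birational map, the exceptional orbits are the orbits of irreducible
closed subsets of codimension one which do not meet the source. -/
lemma mem_exceptionalOrbits_iff {p : V.carrier.PartialIso W.carrier}
    (hp : IsEquivariantBirational p) (hm : IsMaximal p) {E : Set V.carrier} :
    E ∈ exceptionalOrbits p ↔ V.IsOrbitOfDim m E ∧ ¬ (E ∩ p.source).Nonempty := by
  have := V.noetherianSpace
  constructor
  · intro hE
    refine ⟨isOrbitOfDim_of_mem hE, ?_⟩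
    obtain ⟨D, hD, rfl⟩ := hE
    rintro ⟨x, hx, hxs⟩
    obtain ⟨g, y, hy, rfl⟩ := mem_orbit.mp hx
    exact hD.1.1.2 hy p rfl ((hp.act_mem_source_iff hm g).mp hxs)
  · rintro ⟨⟨D, hD, hDi, hDm, rfl⟩, h⟩
    refine ⟨D, ⟨⟨⟨hDi, ?_⟩, ?_⟩, hDm⟩, rfl⟩
    · rw [hm.exceptionalLocus_eq]
      exact fun x hx hxs => h ⟨x, subset_orbit D hx, hxs⟩
    · rintro T ⟨hT, hTe⟩ hDT
      rw [hm.exceptionalLocus_eq] at hTe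
      exact subset_of_disjoint_dense_open V.dim_eq.le p.source.isOpen p.dense_source hD hDm hT
        hTe hDT

lemma exceptionalOrbits_congr {p q : V.carrier.PartialIso W.carrier}
    (h : p.toRationalMap = q.toRationalMap) : exceptionalOrbits p = exceptionalOrbits q := by
  rw [exceptionalOrbits, exceptionalLocus_congr h, exceptionalOrbits]

/-- The sum of the equivariant birational classes of the orbits belonging to `A`. -/
def orbitSum [Finite G] (V : GVariety k G (m + 1)) (A : Set (Set V.carrier)) : ZBir k G m :=
  ∑ᶠ E ∈ A, V.orbitClass m E

lemma orbitSum_inter_add_diff [Finite G] {A : Set (Set V.carrier)} (hA : A.Finite)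
    (B : Set (Set V.carrier)) : V.orbitSum (A ∩ B) + V.orbitSum (A \ B) = V.orbitSum A :=
  finsum_mem_inter_add_sdiff (f := V.orbitClass m) B hA

lemma exceptionalClass_eq_orbitSum [Finite G] (p : V.carrier.PartialIso W.carrier) :
    exceptionalClass p = V.orbitSum (exceptionalOrbits p) := by
  rw [orbitSum, finsum_mem_eq_finite_toFinset_sum (V.orbitClass m) (finite_exceptionalOrbits p),
    exceptionalClass, ← Finset.sum_attach _ (V.orbitClass m)]
  refine Finset.sum_congr rfl fun E _ => ?_
  have hE := isOrbitOfDim_of_mem ((finite_exceptionalOrbits p).mem_toFinset.mp E.2)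
  by_cases hs : V.HasTrivialGenericStabilizer E.1
  · rw [dif_pos hs, orbitClass, dif_pos ⟨hE, hs⟩]
  · rw [dif_neg hs, orbitClass, dif_neg fun h => hs h.2]

lemma invariantC_congr [Finite G] {p q : V.carrier.PartialIso W.carrier}
    (h : p.toRationalMap = q.toRationalMap) : invariantC p = invariantC q := by
  rw [invariantC, invariantC, exceptionalClass_eq_orbitSum, exceptionalClass_eq_orbitSum,
    exceptionalClass_eq_orbitSum, exceptionalClass_eq_orbitSum, exceptionalOrbits_congr h,
    exceptionalOrbits_congr (toRationalMap_symm_congr h)]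

section Composition

variable {φ : V.carrier.PartialIso W.carrier} {ψ : W.carrier.PartialIso W'.carrier}
  {χ : V.carrier.PartialIso W'.carrier}

/-- An orbit which meets the source of `φ` meets the source of the composition of `φ` and `ψ` if
and only if its strict transform under `φ` meets the source of `ψ`. -/
lemma strictTransform_inter_source_nonempty_iff
    (hφ : IsEquivariantBirational φ) (mφ : IsMaximal φ) (mψ : IsMaximal ψ) (mχ : IsMaximal χ)
    (h : χ.toRationalMap = (φ.trans ψ).toRationalMap)
    {E : Set V.carrier} (hE : V.IsOrbitOfDim m E) (hEφ : (E ∩ φ.source).Nonempty) :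
    (strictTransform φ E ∩ ψ.source).Nonempty ↔ (E ∩ χ.source).Nonempty := by
  constructor
  · rintro ⟨y, hy, hyψ⟩
    obtain ⟨y, hyψ, hy⟩ := mem_closure_iff.mp hy _ ψ.source.isOpen hyψ
    obtain ⟨x, hxE, hxy⟩ := mem_partialImage.mp hy
    obtain ⟨z, hz⟩ := exists_mapsPt hyψ
    exact ⟨x, hxE, mχ _ h.symm (mapsPt_trans_iff.mpr ⟨y, hxy, hz⟩).mem_source⟩
  · rintro ⟨x, hxE, hxχ⟩
    obtain ⟨x, hxχ, hxE, hxφ⟩ := mem_closure_iff.mp (hE.subset_closure_inter hφ mφ hEφ hxE) _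
      χ.source.isOpen hxχ
    obtain ⟨y, hy⟩ := exists_mapsPt hxφ
    obtain ⟨z, hz⟩ := exists_mapsPt hxχ
    refine ⟨y, subset_closure (mem_partialImage.mpr ⟨x, hxE, hy⟩),
      mψ (φ.symm.trans χ) ?_ (mapsPt_trans_iff.mpr ⟨x, hy.symm, hz⟩).mem_source⟩
    exact toRationalMap_symm_trans_eq h

variable [IsAlgClosed k] [Finite G]

/-- Taking strict transforms is a class-preserving bijection from the orbits contracted by the
composition of `φ` and `ψ` but not by `φ` to those contracted by `ψ` but not by `φ⁻¹`. -/
lemma orbitSum_exceptionalOrbits_diff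
    (hφ : IsEquivariantBirational φ) (mφ : IsMaximal φ)
    (hψ : IsEquivariantBirational ψ) (mψ : IsMaximal ψ)
    (hχ : IsEquivariantBirational χ) (mχ : IsMaximal χ)
    (h : χ.toRationalMap = (φ.trans ψ).toRationalMap) :
    V.orbitSum (exceptionalOrbits χ \ exceptionalOrbits φ) =
      W.orbitSum (exceptionalOrbits ψ \ exceptionalOrbits φ.symm) := by
  have := V.isReduced
  have := W.isReduced
  have := V.isSeparated_carrier
  have := W.isSeparated_carrier
  have e₁ (E : Set V.carrier) : E ∈ exceptionalOrbits χ \ exceptionalOrbits φ ↔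
      V.IsOrbitOfDim m E ∧ ¬ (E ∩ χ.source).Nonempty ∧ (E ∩ φ.source).Nonempty := by
    rw [Set.mem_sdiff, mem_exceptionalOrbits_iff hφ mφ, mem_exceptionalOrbits_iff hχ mχ]
    tauto
  have e₂ (F : Set W.carrier) : F ∈ exceptionalOrbits ψ \ exceptionalOrbits φ.symm ↔
      W.IsOrbitOfDim m F ∧ ¬ (F ∩ ψ.source).Nonempty ∧ (F ∩ φ.symm.source).Nonempty := by
    rw [Set.mem_sdiff, mem_exceptionalOrbits_iff hφ.symm mφ.symm, mem_exceptionalOrbits_iff hψ mψ]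
    tauto
  refine finsum_mem_eq_of_bijOn (strictTransform φ) ⟨?_, ?_, ?_⟩ ?_
  · intro E hE
    obtain ⟨hE, hEχ, hEφ⟩ := (e₁ E).mp hE
    exact (e₂ _).mpr ⟨hE.strictTransform hφ mφ hEφ,
      (strictTransform_inter_source_nonempty_iff hφ mφ mψ mχ h hE hEφ).not.mpr hEχ,
      strictTransform_inter_target_nonempty hEφ⟩
  · intro E hE E' hE' e
    obtain ⟨hE, -, hEφ⟩ := (e₁ E).mp hE
    obtain ⟨hE', -, hEφ'⟩ := (e₁ E').mp hE'
    rw [← hE.strictTransform_symm_strictTransform hφ mφ hEφ, e,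
      hE'.strictTransform_symm_strictTransform hφ mφ hEφ']
  · intro F hF
    obtain ⟨hF, hFψ, hFφ⟩ := (e₂ F).mp hF
    have hE := hF.strictTransform hφ.symm mφ.symm hFφ
    have hEφ : (strictTransform φ.symm F ∩ φ.source).Nonempty :=
      strictTransform_inter_target_nonempty hFφ
    have e : strictTransform φ (strictTransform φ.symm F) = F :=
      hF.strictTransform_symm_strictTransform hφ.symm mφ.symm hFφ
    refine ⟨_, (e₁ _).mpr ⟨hE, ?_, hEφ⟩, e⟩
    rwa [← strictTransform_inter_source_nonempty_iff hφ mφ mψ mχ h hE hEφ, e]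
  · intro E hE
    obtain ⟨hE, -, hEφ⟩ := (e₁ E).mp hE
    exact (orbitClass_strictTransform hφ mφ hE hEφ).symm

lemma orbitSum_exceptionalOrbits_comp
    (hφ : IsEquivariantBirational φ) (mφ : IsMaximal φ)
    (hψ : IsEquivariantBirational ψ) (mψ : IsMaximal ψ)
    (hχ : IsEquivariantBirational χ) (mχ : IsMaximal χ)
    (h : χ.toRationalMap = (φ.trans ψ).toRationalMap) :
    V.orbitSum (exceptionalOrbits χ) =
      V.orbitSum (exceptionalOrbits φ) - V.orbitSum (exceptionalOrbits φ \ exceptionalOrbits χ) +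
      (W.orbitSum (exceptionalOrbits ψ) -
        W.orbitSum (exceptionalOrbits ψ ∩ exceptionalOrbits φ.symm)) := by
  have h₁ := orbitSum_exceptionalOrbits_diff hφ mφ hψ mψ hχ mχ h
  have h₂ := orbitSum_inter_add_diff (finite_exceptionalOrbits χ) (exceptionalOrbits φ)
  have h₃ := orbitSum_inter_add_diff (finite_exceptionalOrbits φ) (exceptionalOrbits χ)
  have h₄ := orbitSum_inter_add_diff (finite_exceptionalOrbits ψ) (exceptionalOrbits φ.symm)
  rw [← h₂, ← h₃, ← h₄, h₁, Set.inter_comm (exceptionalOrbits χ)]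
  abel

/-- The correction terms in `orbitSum_exceptionalOrbits_comp` for `χ` and for `χ⁻¹` coincide. -/
lemma invariantC_comp_of_isMaximal
    (hφ : IsEquivariantBirational φ) (mφ : IsMaximal φ)
    (hψ : IsEquivariantBirational ψ) (mψ : IsMaximal ψ)
    (hχ : IsEquivariantBirational χ) (mχ : IsMaximal χ)
    (h : χ.toRationalMap = (φ.trans ψ).toRationalMap) :
    invariantC χ = invariantC φ + invariantC ψ := by
  have := V.isReduced
  have := W.isReduced
  have := W'.isReduced
  have := V.isSeparated_carrier
  have := W.isSeparated_carrier
  have := W'.isSeparated_carrier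
  have h' : χ.symm.toRationalMap = (ψ.symm.trans φ.symm).toRationalMap :=
    (toRationalMap_symm_congr h).trans (symm_trans_toRationalMap φ ψ)
  have h₁ := orbitSum_exceptionalOrbits_comp hφ mφ hψ mψ hχ mχ h
  have h₂ := orbitSum_exceptionalOrbits_comp hψ.symm mψ.symm hφ.symm mφ.symm hχ.symm mχ.symm h'
  have h₃ := orbitSum_exceptionalOrbits_diff hχ mχ hψ.symm mψ.symm hφ mφ
    (toRationalMap_trans_symm_eq h).symm
  have h₄ : W.orbitSum (exceptionalOrbits φ.symm ∩ exceptionalOrbits ψ.symm.symm) =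
      W.orbitSum (exceptionalOrbits ψ ∩ exceptionalOrbits φ.symm) := by
    rw [Set.inter_comm]
    rfl
  simp only [invariantC, exceptionalClass_eq_orbitSum]
  rw [h₁, h₂, h₃, h₄]
  abel

end Composition

end GVariety

end EquivBir

end

theorem theorem1 {k : Type u} [Field k] [IsAlgClosed k] [CharZero k]
    {G : Type v} [Group G] [Finite G] {m : ℕ} {X Y Z : EquivBir.GVariety k G (m + 1)}
    (hX : X.IsSmoothProjective) (hY : Y.IsSmoothProjective) (hZ : Z.IsSmoothProjective)
    (φ : X.carrier.PartialIso Y.carrier) (hφ : EquivBir.GVariety.IsEquivariantBirational φ)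
    (ψ : Y.carrier.PartialIso Z.carrier) (hψ : EquivBir.GVariety.IsEquivariantBirational ψ) :
    EquivBir.GVariety.invariantC (φ.trans ψ) =
      EquivBir.GVariety.invariantC φ + EquivBir.GVariety.invariantC ψ := by
  have := X.isReduced
  have := Y.isReduced
  have := Z.isReduced
  have := X.isSeparated_carrier
  have := Y.isSeparated_carrier
  have := Z.isSeparated_carrier
  obtain ⟨φ', eφ, mφ⟩ := EquivBir.exists_isMaximal φ
  obtain ⟨ψ', eψ, mψ⟩ := EquivBir.exists_isMaximal ψ
  obtain ⟨χ, eχ, mχ⟩ := EquivBir.exists_isMaximal (φ.trans ψ)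
  rw [← EquivBir.GVariety.invariantC_congr eφ, ← EquivBir.GVariety.invariantC_congr eψ,
    ← EquivBir.GVariety.invariantC_congr eχ]
  exact EquivBir.GVariety.invariantC_comp_of_isMaximal (hφ.congr eφ.symm) mφ (hψ.congr eψ.symm) mψ
    ((hφ.trans hψ).congr eχ.symm) mχ
    (eχ.trans (EquivBir.toRationalMap_trans_congr eφ.symm eψ.symm))
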